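/- **Setting.** Let $d\ge 1$, $\sigma>0$ and $0<\alpha\le\beta$. Let $\Omega\subset\mathbb R^d$ be a bounded, connected, open polytope, and let $A$ be a measurable scalar coefficient with $\alpha\le A\le\beta$ a.e. in $\Omega$. Let $\mathcal T_h$ be a mesh of $\Omega$ consisting of finitely many closed parallelepipeds that cover $\overline\Omega$, do not overlap, intersect pairwise only in (possibly empty) common faces and resolve $\partial\Omega$ by faces. Let $\mathcal T_h$ be regular and quasi-uniform with characteristic mesh size $h>0$: every element has diameter at most $\sigma h$ and contains a ball of radius $h/\sigma$. Let $V_h$ be the space of continuous functions on $\overline\Omega$ that vanish on $\partial\Omega$ and are, on each element and in reference coordinates, polynomials of coordinate degree at most one (extended by zero). For $\omega\subseteq\overline\Omega$ write $(v,w)_\omega=\int_\omega vw$, $a_\omega(v,w)=\int_\omega A\nabla v\cdot\nabla w$ (the index is dropped for $\omega=\Omega$) and, for $\tau>0$, $$|||v|||_\omega^2=\|v\|_{L^2(\omega)}^2+\tfrac{\tau^2}{4}a_\omega(v,v),\qquad |||v|||=|||v|||_\Omega .$$ For $\omega\subseteq\overline\Omega$ put $\mathtt N_0(\omega)=\operatorname{int}\omega$,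 $\mathtt N_1(\omega)=\mathtt N(\omega)=\operatorname{int}\bigcup\{K\in\mathcal T_h: K\cap\overline\omega\ne\emptyset\}$ and $\mathtt N_\ell(\omega)=\mathtt N(\mathtt N_{\ell-1}(\omega))$ for $\ell\ge2$. A sequence $(u_h^k)$ in $V_h$ solves the Crank--Nicolson scheme with time step $\tau$ if, for all $k\ge1$ and all $v_h\in V_h$, $$\tau^{-2}(u_h^{k+1}-2u_h^k+u_h^{k-1},v_h)+\tfrac14a(u_h^{k+1}+2u_h^k+u_h^{k-1},v_h)=\tfrac14(f_h^{k+1}+2f_h^k+f_h^{k-1},v_h),$$ where $f_h^k\in V_h$ is the $L^2$-projection of $f(k\tau)\in L^2(\Omega)$ onto $V_h$ or any other approximation that is supported in the set $\omega$ below. Put $u_h^{k+1/2}=\tfrac12(u_h^{k+1}+u_h^k)$. **Statement.** There are constants $c_1,c_2>0$, depending only on $d$, $\alpha$, $\beta$ and the mesh regularity parameter $\sigma$, and numbers $C_{\tau,h}$, $\tau,h>0$, depending only on these parameters and on $\tau$ and $h$, with $$c_1\,\tfrac{\beta}{\alpha}\Big(\tfrac{\tau}{h}+\tfrac{h}{\tau}\Big)\le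 C_{\tau,h}\le c_2\,\tfrac{\beta}{\alpha}\Big(\tfrac{\tau}{h}+\tfrac{h}{\tau}\Big),\qquad 0<\gamma:=\sqrt{\frac{C_{\tau,h}+\frac12}{1+C_{\tau,h}}}<1,$$ such that the following holds for all $\Omega$, $A$, $\mathcal T_h$ and $\tau$ as above. If $\omega$ is a union of (closed) elements, and $f$, $u_h^0$ and $u_h^1$ are supported in $\omega$, then for all $n,\ell\in\mathbb N_0$ $$|||u_h^{n+1/2}|||_{\Omega\setminus\mathtt N_\ell(\omega)}\le(\ell+1)^{n/2}\,\gamma^\ell\max_{0\le k\le n}|||u_h^{k+1/2}|||.$$ -/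

import Mathlib

open MeasureTheory

namespace WaveCN

/-- Euclidean space `ℝ^d`. -/
abbrev E (d : ℕ) : Type := EuclideanSpace ℝ (Fin d)

/-- The closed reference cube `[0,1]^d`. -/
def unitCube (d : ℕ) : Set (E d) := {x | ∀ i, x i ∈ Set.Icc (0 : ℝ) 1}

/-- The face of the reference cube on which the coordinates in `I₀` are `0` and those in `I₁`
are `1` (empty if `I₀` and `I₁` intersect, the whole cube if both are empty). -/
def cubeFace {d : ℕ} (I₀ I₁ : Finset (Fin d)) : Set (E d) :=
  {x | x ∈ unitCube d ∧ (∀ i ∈ I₀, x i = 0) ∧ (∀ i ∈ I₁, x i = 1)}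

/-- A conforming mesh (no hanging nodes) of `Ω` consisting of finitely many closed parallelepipeds,
each given as the image of the reference cube under an invertible affine map. -/
structure Mesh (d : ℕ) (Ω : Set (E d)) where
  /-- the number of elements -/
  card : ℕ
  /-- the affine reference maps -/
  map : Fin card → (E d ≃ᵃ[ℝ] E d)
  /-- the elements cover the closure of the domain -/
  cover : (⋃ i, map i '' unitCube d) = closure Ω
  /-- distinct elements do not overlap -/
  interior_disjoint : ∀ i j, i ≠ j →
    Disjoint (interior (map i '' unitCube d)) (interior (map j '' unitCube d))
  /-- the intersection of two distinct elements is a (possibly empty) common face -/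
  conforming : ∀ i j, i ≠ j → ∃ I₀ I₁ J₀ J₁ : Finset (Fin d),
    (map i '' unitCube d) ∩ (map j '' unitCube d) = map i '' cubeFace I₀ I₁ ∧
    (map i '' unitCube d) ∩ (map j '' unitCube d) = map j '' cubeFace J₀ J₁
  /-- the boundary of the domain is resolved by faces of elements -/
  boundary : ∀ i, ∀ x ∈ (map i '' unitCube d) ∩ frontier Ω, ∃ I₀ I₁ : Finset (Fin d),
    x ∈ map i '' cubeFace I₀ I₁ ∧ map i '' cubeFace I₀ I₁ ⊆ frontier Ω

namespace Mesh

variable {d : ℕ} {Ω : Set (E d)} (M : Mesh d Ω)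

/-- The `i`-th (closed) element. -/
def elem (i : Fin M.card) : Set (E d) := M.map i '' unitCube d

/-- The union of the closed elements with index in `S`. -/
def elemUnion (S : Finset (Fin M.card)) : Set (E d) := ⋃ i ∈ S, M.elem i

/-- Shape regularity and quasi-uniformity with characteristic mesh size `h` and constant `σ`:
every element has diameter at most `σ h` and contains a ball of radius `h / σ`. -/
def IsQuasiUniform (σ h : ℝ) : Prop :=
  ∀ i, Metric.diam (M.elem i) ≤ σ * h ∧ ∃ x, Metric.closedBall x (h / σ) ⊆ M.elem i

/-- The element neighbourhood `N(ω)`: the interior of the union of all closed elements that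
intersect the closure of `ω`. -/
def nbhd (ω : Set (E d)) : Set (E d) :=
  interior (⋃ i ∈ {i : Fin M.card | (closure ω ∩ M.elem i).Nonempty}, M.elem i)

/-- The `ℓ`-th order element patch `N_ℓ(ω)`. -/
def patch (ω : Set (E d)) : ℕ → Set (E d)
  | 0 => interior ω
  | 1 => M.nbhd ω
  | ℓ + 2 => M.nbhd (patch ω (ℓ + 1))

/-- The `Q₁` finite element space `V_h`: continuous functions that vanish outside `Ω` (functions on
`Ω` with zero boundary values are identified with their extension by zero) and that are, on each
element and in reference coordinates, polynomials of coordinate degree at most one. -/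
def femSpace : Submodule ℝ (E d → ℝ) where
  carrier := {u | Continuous u ∧ (∀ x ∉ Ω, u x = 0) ∧
    ∀ i, ∃ p ∈ MvPolynomial.restrictDegree (Fin d) ℝ 1, ∀ x ∈ unitCube d,
      u (M.map i x) = MvPolynomial.eval (fun j => x j) p}
  zero_mem' := ⟨continuous_const, fun _ _ => rfl, fun _ => ⟨0, Submodule.zero_mem _, by simp⟩⟩
  add_mem' := by
    rintro u v ⟨hu, hu0, hup⟩ ⟨hv, hv0, hvp⟩
    refine ⟨hu.add hv, fun x hx => by simp [hu0 x hx, hv0 x hx], fun i => ?_⟩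
    obtain ⟨p, hp, hpe⟩ := hup i
    obtain ⟨q, hq, hqe⟩ := hvp i
    exact ⟨p + q, Submodule.add_mem _ hp hq, fun x hx => by simp [hpe x hx, hqe x hx]⟩
  smul_mem' := by
    rintro c u ⟨hu, hu0, hup⟩
    refine ⟨hu.const_smul c, fun x hx => by simp [hu0 x hx], fun i => ?_⟩
    obtain ⟨p, hp, hpe⟩ := hup i
    exact ⟨c • p, Submodule.smul_mem _ c hp, fun x hx => by
      simp [hpe x hx, MvPolynomial.smul_eval]⟩

end Mesh

noncomputable section

variable {d : ℕ}

/-- The `L²(ω)` inner product `(u, v)_ω`. -/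
def l2 (ω : Set (E d)) (u v : E d → ℝ) : ℝ := ∫ x in ω, u x * v x

/-- The bilinear form `a_ω(u, v) = (A ∇u, ∇v)_ω`. It is applied to piecewise polynomial continuous
functions, whose weak gradient is the classical gradient in the interior of the elements, that
is, almost everywhere. -/
def aForm (A : E d → ℝ) (ω : Set (E d)) (u v : E d → ℝ) : ℝ :=
  ∫ x in ω, A x * inner ℝ (gradient u x) (gradient v x)

/-- The norm `|||v|||_ω = (‖v‖²_{L²(ω)} + τ²/4 ‖v‖²_{a,ω})^{1/2}`. -/
def tnorm (A : E d → ℝ) (τ : ℝ) (ω : Set (E d)) (v : E d → ℝ) : ℝ :=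
  Real.sqrt (l2 ω v v + τ ^ 2 / 4 * aForm A ω v v)

/-- The second-order centred difference quotient (used for `n ≥ 1` only). -/
def secondDiff (τ : ℝ) (z : ℕ → E d → ℝ) (n : ℕ) : E d → ℝ :=
  (τ ^ 2)⁻¹ • (z (n + 1) - (2 : ℝ) • z n + z (n - 1))

/-- The weighted average `(z^{n+1} + 2 z^n + z^{n-1}) / 4` (used for `n ≥ 1` only). -/
def avg (z : ℕ → E d → ℝ) (n : ℕ) : E d → ℝ :=
  (1 / 4 : ℝ) • (z (n + 1) + (2 : ℝ) • z n + z (n - 1))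

/-- The half-step value `z^{n+1/2} = (z^{n+1} + z^n) / 2`. -/
def halfStep (z : ℕ → E d → ℝ) (n : ℕ) : E d → ℝ := (1 / 2 : ℝ) • (z (n + 1) + z n)

/-- `u⁰, …, u^{n+1}` in `V_h` solve the Crank--Nicolson scheme with discrete source `fh`
in the time steps `1, …, n`. -/
def IsCNSolution {Ω : Set (E d)} (M : Mesh d Ω) (A : E d → ℝ) (τ : ℝ)
    (fh u : ℕ → E d → ℝ) (n : ℕ) : Prop :=
  (∀ k ≤ n + 1, u k ∈ M.femSpace) ∧
  ∀ k, 1 ≤ k → k ≤ n → ∀ v ∈ M.femSpace,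
    l2 Ω (secondDiff τ u k) v + aForm A Ω (avg u k) v = l2 Ω (avg fh k) v

/-- `w` is the `L²(Ω)`-projection of `g` onto `V_h`. -/
def IsL2Projection {Ω : Set (E d)} (M : Mesh d Ω) (g w : E d → ℝ) : Prop :=
  w ∈ M.femSpace ∧ ∀ v ∈ M.femSpace, l2 Ω w v = l2 Ω g v

/-- The decay factor `γ = ((C + 1/2) / (1 + C))^{1/2}`. -/
def decayFactor (C : ℝ) : ℝ := Real.sqrt ((C + 1 / 2) / (1 + C))

end

end WaveCN

/-! Write `z^k` for the half-step value `u^{k+1/2}` and `b = l2 + τ²/4 * aForm`, the bilinear form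
behind the norm `tnorm`. Averaging two consecutive equations of the scheme, tested with a `v` in
`V_h` that vanishes on `ω`, removes the source and gives `b(z^{k+2}, v) = 2 (z^{k+1}, v) - τ²/2
a(z^{k+1}, v) - b(z^k, v)`. So `z^{k+2}` solves a coercive elliptic problem outside `ω` whose
right-hand side involves only the two preceding half steps.

Take for `v` the nodal truncation of `z^{k+2}`: zero on the `ℓ`-th patch, equal to `z^{k+2}` outside
the next one. Outside the next patch the left-hand side is the full energy; on the ring between the
patches, inverse estimates bound all terms at the price of a factor of order `1 + τ/h`. Hence the
outer energy at level `ℓ+1` is at most a multiple of the energy lost between the levels, plus the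
outer energies of the two preceding half steps (`exists_outerEnergy_step`). Absorbing the lost
energy gives a contraction by `γ²` per layer (`le_decayFactor_sq_mul`).

The energies `m k ℓ` of `z^k` outside the patches then satisfy `m (k+2) (ℓ+1) ≤ γ² (m (k+2) ℓ + (m
(k+1) ℓ + m k ℓ)/2)`. Each time step costs at most one factor `ℓ+1` (`decay_of_recursion`), and a
square root turns `(ℓ+1)^n γ^{2ℓ}` into the claim.

The truncation must belong to `V_h`: on parallelepipeds of arbitrary orientation, vertex values have
to define a continuous function. This holds because the change of reference coordinates on a common
face maps edges to edges (`interp_comp_eq`, `exists_mem_femSpace`). -/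

namespace WaveCN

/-! ### Multiaffine functions and `Q₁` interpolation on the reference cube. -/

section Multiaffine

variable {d : ℕ}

/-- A function of `d` real variables that is affine in each variable separately. -/
def IsMultiaffine (g : (Fin d → ℝ) → ℝ) : Prop :=
  ∀ x a, g x = (1 - x a) * g (Function.update x a 0) + x a * g (Function.update x a 1)

/-- The vertices of the reference cube. -/
def corner (e : Fin d → Bool) : E d := WithLp.toLp 2 fun i => if e i then 1 else 0

/-- The `Q₁` shape function of a vertex of the reference cube. -/
def shape (e : Fin d → Bool) (x : Fin d → ℝ) : ℝ := ∏ i, if e i then x i else 1 - x i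

/-- The `Q₁` interpolant of given vertex values. -/
def interp (c : (Fin d → Bool) → ℝ) (x : Fin d → ℝ) : ℝ := ∑ e, c e * shape e x

theorem corner_apply (e : Fin d → Bool) (i : Fin d) :
    corner e i = if e i then 1 else 0 := rfl

theorem corner_eq_zero_or_one (e : Fin d → Bool) (i : Fin d) :
    corner e i = 0 ∨ corner e i = 1 := by
  rw [corner_apply]; split_ifs <;> simp

theorem corner_mem_unitCube (e : Fin d → Bool) : corner e ∈ unitCube d := by
  intro i
  rcases corner_eq_zero_or_one e i with h | h <;> simp [h]

theorem exists_corner_eq {x : E d} (hx : ∀ i, x i = 0 ∨ x i = 1) : ∃ e, corner e = x := by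
  refine ⟨fun i => decide (x i = 1), ?_⟩
  ext i
  rw [corner_apply]
  rcases hx i with h | h <;> simp [h]

namespace IsMultiaffine

theorem sub {f g : (Fin d → ℝ) → ℝ} (hf : IsMultiaffine f) (hg : IsMultiaffine g) :
    IsMultiaffine fun x => f x - g x := by
  intro x a
  have h1 := hf x a
  have h2 := hg x a
  linear_combination h1 - h2

theorem sum {ι : Type*} (s : Finset ι) (c : ι → ℝ) {f : ι → (Fin d → ℝ) → ℝ}
    (hf : ∀ i ∈ s, IsMultiaffine (f i)) : IsMultiaffine fun x => ∑ i ∈ s, c i * f i x := by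
  intro x a
  simp only [Finset.mul_sum]
  rw [← Finset.sum_add_distrib]
  refine Finset.sum_congr rfl fun i hi => ?_
  rw [hf i hi x a]
  ring

theorem prod {f : Fin d → ℝ → ℝ} (hf : ∀ i t, f i t = (1 - t) * f i 0 + t * f i 1) :
    IsMultiaffine fun x => ∏ i, f i (x i) := by
  intro x a
  have key : ∀ t, ∏ i, f i (Function.update x a t i)
      = f a t * ∏ i ∈ Finset.univ.erase a, f i (x i) := by
    intro t
    rw [← Finset.mul_prod_erase Finset.univ _ (Finset.mem_univ a), Function.update_self]
    congr 1
    refine Finset.prod_congr rfl fun i hi => ?_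
    rw [Function.update_of_ne (Finset.ne_of_mem_erase hi)]
  have h := key (x a)
  rw [Function.update_eq_self] at h
  simp only [h, key]
  rw [hf a (x a)]
  ring

theorem update_eq {g : (Fin d → ℝ) → ℝ} (hg : IsMultiaffine g) (x : Fin d → ℝ) (a : Fin d)
    (t : ℝ) : g (Function.update x a t) =
      g (Function.update x a 0) + t * (g (Function.update x a 1) - g (Function.update x a 0)) := by
  have h := hg (Function.update x a t) a
  simp only [Function.update_idem, Function.update_self] at h
  rw [h]; ring

/-- Induction on the set of coordinates that are not yet 0 or 1: affinity in one coordinate reduces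
the value to the two endpoints. This is the unisolvence of the vertex values. -/
theorem eq_zero {g : (Fin d → ℝ) → ℝ} (hg : IsMultiaffine g) (h0 : ∀ e, g (corner e) = 0)
    (x : Fin d → ℝ) : g x = 0 := by
  have key : ∀ (s : Finset (Fin d)) (x : Fin d → ℝ),
      (∀ i ∉ s, x i = 0 ∨ x i = 1) → g x = 0 := by
    intro s
    induction s using Finset.induction_on with
    | empty =>
      intro x hx
      obtain ⟨e, he⟩ := exists_corner_eq (x := WithLp.toLp 2 x) fun i => hx i (by simp)
      have := h0 e
      rwa [he] at this
    | insert a s _ ih =>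
      intro x hx
      have h : ∀ t : ℝ, (t = 0 ∨ t = 1) → g (Function.update x a t) = 0 := by
        intro t ht
        refine ih _ fun i hi => ?_
        by_cases hia : i = a
        · subst hia; simpa using ht
        · rw [Function.update_of_ne hia]
          exact hx i (by simp [hia, hi])
      rw [hg x a, h 0 (by simp), h 1 (by simp)]
      ring
  exact key Finset.univ x (by simp)

end IsMultiaffine

theorem isMultiaffine_shape (e : Fin d → Bool) : IsMultiaffine (shape e) := by
  refine IsMultiaffine.prod (f := fun i t => if e i then t else 1 - t) fun i t => ?_
  split_ifs <;> ring

theorem isMultiaffine_interp (c : (Fin d → Bool) → ℝ) : IsMultiaffine (interp c) :=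
  IsMultiaffine.sum _ _ fun e _ => isMultiaffine_shape e

theorem shape_corner (e e' : Fin d → Bool) : shape e (corner e') = if e = e' then 1 else 0 := by
  unfold shape
  split_ifs with h
  · subst h
    refine Finset.prod_eq_one fun i _ => ?_
    rw [corner_apply]; cases e i <;> simp
  · obtain ⟨i, hi⟩ := Function.ne_iff.1 h
    refine Finset.prod_eq_zero (Finset.mem_univ i) ?_
    rw [corner_apply]
    cases h1 : e i <;> cases h2 : e' i <;> simp_all

theorem interp_corner (c : (Fin d → Bool) → ℝ) (e : Fin d → Bool) :
    interp c (corner e) = c e := by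
  simp [interp, shape_corner]

theorem IsMultiaffine.eq_interp {g : (Fin d → ℝ) → ℝ} (hg : IsMultiaffine g)
    (x : Fin d → ℝ) : g x = interp (fun e => g (corner e)) x := by
  have := (hg.sub (isMultiaffine_interp fun e => g (corner e))).eq_zero
    (fun e => by rw [interp_corner, sub_self]) x
  exact sub_eq_zero.1 this

theorem isMultiaffine_eval {p : MvPolynomial (Fin d) ℝ}
    (hp : p ∈ MvPolynomial.restrictDegree (Fin d) ℝ 1) :
    IsMultiaffine fun x => MvPolynomial.eval x p := by
  simp only [MvPolynomial.eval_eq']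
  refine IsMultiaffine.sum p.support (fun m => p.coeff m) fun m hm => ?_
  refine IsMultiaffine.prod (f := fun i t => t ^ m i) fun i t => ?_
  have h := (MvPolynomial.mem_restrictDegree _ _ _).1 hp m hm i
  interval_cases m i <;> ring

/-- The polynomial representing the interpolant of given vertex values. -/
noncomputable def interpPoly (c : (Fin d → Bool) → ℝ) : MvPolynomial (Fin d) ℝ :=
  ∑ e, c e • ∏ i, if e i then MvPolynomial.X i else 1 - MvPolynomial.X i

theorem eval_interpPoly (c : (Fin d → Bool) → ℝ) (x : Fin d → ℝ) :
    MvPolynomial.eval x (interpPoly c) = interp c x := by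
  simp only [interpPoly, interp, shape, map_sum, MvPolynomial.smul_eval, map_prod]
  refine Finset.sum_congr rfl fun e _ => ?_
  congr 1
  refine Finset.prod_congr rfl fun i _ => ?_
  split_ifs <;> simp

theorem interpPoly_mem (c : (Fin d → Bool) → ℝ) :
    interpPoly c ∈ MvPolynomial.restrictDegree (Fin d) ℝ 1 := by
  refine Submodule.sum_mem _ fun e _ => Submodule.smul_mem _ _ ?_
  rw [MvPolynomial.mem_restrictDegree_iff_sup]
  intro n
  have h1 : ∀ j, MvPolynomial.degreeOf n
      (if e j then MvPolynomial.X j else 1 - MvPolynomial.X j : MvPolynomial (Fin d) ℝ)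
        ≤ if n = j then 1 else 0 := by
    intro j
    have hX : MvPolynomial.degreeOf n (MvPolynomial.X j : MvPolynomial (Fin d) ℝ)
        ≤ if n = j then 1 else 0 := by rw [MvPolynomial.degreeOf_X]
    split
    · exact hX
    · refine (MvPolynomial.degreeOf_sub_le _ _ _).trans (max_le ?_ hX)
      rw [MvPolynomial.degreeOf_one]; exact Nat.zero_le _
  have h2 := (MvPolynomial.degreeOf_prod_le n Finset.univ fun j =>
    (if e j then MvPolynomial.X j else 1 - MvPolynomial.X j : MvPolynomial (Fin d) ℝ)).trans
      (Finset.sum_le_sum fun j _ => h1 j)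
  simpa [MvPolynomial.degreeOf_def] using h2

/-- A vertex off the face differs from it in some fixed coordinate, and the corresponding factor of
the shape function vanishes on the face. Hence the trace on a face depends only on the vertices of
that face. -/
theorem shape_eq_zero_of_mem_cubeFace {I₀ I₁ : Finset (Fin d)} {x : E d}
    (hx : x ∈ cubeFace I₀ I₁) {e : Fin d → Bool} (he : corner e ∉ cubeFace I₀ I₁) :
    shape e x = 0 := by
  have : (∃ i ∈ I₀, corner e i ≠ 0) ∨ ∃ i ∈ I₁, corner e i ≠ 1 := by
    by_contra! h
    exact he ⟨corner_mem_unitCube e, h.1, h.2⟩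
  obtain ⟨i, hi, h⟩ | ⟨i, hi, h⟩ := this
  · refine Finset.prod_eq_zero (Finset.mem_univ i) ?_
    rw [corner_apply] at h
    cases he : e i <;> simp_all [hx.2.1 i hi]
  · refine Finset.prod_eq_zero (Finset.mem_univ i) ?_
    rw [corner_apply] at h
    cases he : e i <;> simp_all [hx.2.2 i hi]

theorem interp_congr_of_mem_cubeFace {I₀ I₁ : Finset (Fin d)} {x : E d}
    (hx : x ∈ cubeFace I₀ I₁) {c c' : (Fin d → Bool) → ℝ}
    (h : ∀ e, corner e ∈ cubeFace I₀ I₁ → c e = c' e) : interp c x = interp c' x := by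
  refine Finset.sum_congr rfl fun e _ => ?_
  by_cases he : corner e ∈ cubeFace I₀ I₁
  · rw [h e he]
  · rw [shape_eq_zero_of_mem_cubeFace hx he]; simp

end Multiaffine

/-! ### Compatibility of interpolants across a common face. -/

section Gluing

variable {d : ℕ} {I₀ I₁ J₀ J₁ : Finset (Fin d)} {T : E d ≃ᵃ[ℝ] E d}

/-- If the image of `x` lies strictly between the two facets of the cube in direction `j`, then
the direction `j` is pulled back to a direction that fixes the coordinates in which `x` lies on a
facet. -/
theorem linear_symm_single_eq_zero (hT : T '' cubeFace I₀ I₁ = cubeFace J₀ J₁) {x : E d}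
    (hx : x ∈ cubeFace I₀ I₁) {j : Fin d} (h0 : 0 < T x j) (h1 : T x j < 1) {i : Fin d}
    (hi : x i = 0 ∨ x i = 1) : T.linear.symm (EuclideanSpace.single j (1 : ℝ)) i = 0 := by
  have hy : T x ∈ cubeFace J₀ J₁ := hT ▸ Set.mem_image_of_mem T hx
  have hj0 : j ∉ J₀ := fun h => h0.ne' (hy.2.1 j h)
  have hj1 : j ∉ J₁ := fun h => h1.ne (hy.2.2 j h)
  -- Direction `j` is free in the target face, so `T x` may be shifted along it without leaving the
  -- face, and the preimage stays in the cube.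
  have move : ∀ t : ℝ, 0 ≤ T x j + t → T x j + t ≤ 1 →
      x i + t * T.linear.symm (EuclideanSpace.single j (1 : ℝ)) i ∈ Set.Icc (0 : ℝ) 1 := by
    intro t ht0 ht1
    have hmem : T x + t • EuclideanSpace.single j (1 : ℝ) ∈ cubeFace J₀ J₁ := by
      refine ⟨fun k => ?_, fun k hk => ?_, fun k hk => ?_⟩
      · by_cases hk : k = j
        · subst hk; simpa using ⟨ht0, ht1⟩
        · simpa [hk] using hy.1 k
      · have : k ≠ j := fun h => hj0 (h ▸ hk)
        simpa [this] using hy.2.1 k hk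
      · have : k ≠ j := fun h => hj1 (h ▸ hk)
        simpa [this] using hy.2.2 k hk
    rw [← hT] at hmem
    obtain ⟨x', hx', he⟩ := hmem
    have : x' = x + t • T.linear.symm (EuclideanSpace.single j (1 : ℝ)) := by
      apply T.injective
      rw [he, add_comm x, ← vadd_eq_add (_ • _) x, T.map_vadd, vadd_eq_add, map_smul,
        LinearEquiv.apply_symm_apply, add_comm]
    have h := hx'.1 i
    rw [this] at h
    simpa using h
  set w := T.linear.symm (EuclideanSpace.single j (1 : ℝ)) i
  obtain ⟨ε, hε, he0, he1⟩ : ∃ ε : ℝ, 0 < ε ∧ ε ≤ T x j ∧ ε ≤ 1 - T x j :=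
    ⟨min (T x j) (1 - T x j), lt_min h0 (by linarith), min_le_left _ _, min_le_right _ _⟩
  have ha := move ε (by linarith) (by linarith)
  have hb := move (-ε) (by linarith) (by linarith)
  -- Shifts of both signs keep coordinate `i` in `[0,1]`, although it starts at an endpoint.
  have : ε * w = 0 := by
    rcases hi with h | h <;> rw [h] at ha hb <;> simp only [Set.mem_Icc] at ha hb <;>
      linarith [ha.1, ha.2, hb.1, hb.2]
  exact (mul_eq_zero.1 this).resolve_left hε.ne'

/-- At a vertex every coordinate is 0 or 1, so a strictly intermediate image coordinate would pull a
basis vector back to zero. -/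
theorem map_corner_eq_zero_or_one (hT : T '' cubeFace I₀ I₁ = cubeFace J₀ J₁)
    {e : Fin d → Bool} (he : corner e ∈ cubeFace I₀ I₁) (j : Fin d) :
    T (corner e) j = 0 ∨ T (corner e) j = 1 := by
  have hy : T (corner e) ∈ cubeFace J₀ J₁ := hT ▸ Set.mem_image_of_mem T he
  by_contra! h
  have hz : T.linear.symm (EuclideanSpace.single j (1 : ℝ)) = 0 := by
    ext i
    exact linear_symm_single_eq_zero hT he (lt_of_le_of_ne (hy.1 j).1 h.1.symm)
      (lt_of_le_of_ne (hy.1 j).2 h.2) (corner_eq_zero_or_one e i)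
  have := congrArg (fun v : E d => v j) ((LinearEquiv.map_eq_zero_iff _).1 hz)
  simp at this

/-- Edge directions of a face are mapped to edge directions. -/
theorem exists_linear_single_eq (hT : T '' cubeFace I₀ I₁ = cubeFace J₀ J₁)
    (hne : (cubeFace I₀ I₁).Nonempty) {a : Fin d} (ha0 : a ∉ I₀) (ha1 : a ∉ I₁) :
    ∃ (j : Fin d) (r : ℝ), T.linear (EuclideanSpace.single a (1 : ℝ))
      = r • EuclideanSpace.single j (1 : ℝ) := by
  obtain ⟨p, hp⟩ := hne
  classical
  -- For `t` in `[0,1]` this runs through an edge of the face in direction `a`; at `t = 1/2` only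
  -- coordinate `a` is away from 0 and 1.
  let m : ℝ → E d := fun t =>
    WithLp.toLp 2 fun i => if i = a then t else if i ∈ I₁ then 1 else 0
  have hm : ∀ t ∈ Set.Icc (0 : ℝ) 1, m t ∈ cubeFace I₀ I₁ := by
    intro t ht
    refine ⟨fun i => ?_, fun i hi => ?_, fun i hi => ?_⟩
    · simp only [m]; split_ifs
      · exact ht
      · simp
      · simp
    · have h1 : i ∉ I₁ := fun h => by have := hp.2.1 i hi; rw [hp.2.2 i h] at this; simp at this
      have h2 : i ≠ a := fun h => ha0 (h ▸ hi)
      simp [m, h1, h2]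
    · have h2 : i ≠ a := fun h => ha1 (h ▸ hi)
      simp [m, hi, h2]
  set w := T.linear (EuclideanSpace.single a (1 : ℝ)) with hw
  have hline : ∀ t s, T (m t) = T (m s) + (t - s) • w := by
    intro t s
    have : m t = (t - s) • EuclideanSpace.single a (1 : ℝ) +ᵥ m s := by
      ext i
      by_cases hi : i = a <;> simp [m, hi]
    rw [this, T.map_vadd, vadd_eq_add, map_smul, add_comm]
  have hw0 : w ≠ 0 := by
    intro h
    have := congrArg (fun v : E d => v a) ((LinearEquiv.map_eq_zero_iff _).1 h)
    simp at this
  obtain ⟨j, hj⟩ : ∃ j, w j ≠ 0 := by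
    by_contra! h
    exact hw0 (by ext i; simpa using h i)
  have hin : ∀ t ∈ Set.Icc (0 : ℝ) 1, T (m t) j ∈ Set.Icc (0 : ℝ) 1 := by
    intro t ht
    have : T (m t) ∈ cubeFace J₀ J₁ := hT ▸ Set.mem_image_of_mem T (hm t ht)
    exact this.1 j
  have e0 := hin 0 (by simp)
  have e1 := hin 1 (by simp)
  have l0 := congrArg (fun v : E d => v j) (hline 0 (1 / 2))
  have l1 := congrArg (fun v : E d => v j) (hline 1 (1 / 2))
  simp only [PiLp.add_apply, PiLp.smul_apply, smul_eq_mul] at l0 l1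
  rw [l0] at e0
  rw [l1] at e1
  have hh : m (1 / 2) ∈ cubeFace I₀ I₁ := hm _ (by norm_num)
  -- Coordinate `j` is affine and nonconstant along the edge with values in `[0,1]`, so its midpoint
  -- value is strictly inside.
  have hpos : 0 < T (m (1 / 2)) j ∧ T (m (1 / 2)) j < 1 := by
    simp only [Set.mem_Icc] at e0 e1
    rcases lt_or_gt_of_ne hj with h | h <;> constructor <;> linarith [e0.1, e0.2, e1.1, e1.2]
  have hv : ∀ i, i ≠ a → T.linear.symm (EuclideanSpace.single j (1 : ℝ)) i = 0 := by
    intro i hi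
    refine linear_symm_single_eq_zero hT hh hpos.1 hpos.2 ?_
    simp only [m, hi, if_false]
    split_ifs <;> simp
  set v := T.linear.symm (EuclideanSpace.single j (1 : ℝ)) with hvdef
  have hva : v = v a • EuclideanSpace.single a (1 : ℝ) := by
    ext i
    by_cases hi : i = a
    · subst hi; simp
    · simp [hi, hv i hi]
  have hTv : EuclideanSpace.single j (1 : ℝ) = v a • w := by
    rw [hw, ← map_smul, ← hva, hvdef, LinearEquiv.apply_symm_apply]
  have hva0 : v a ≠ 0 := by
    intro h
    rw [h, zero_smul] at hTv
    have := congrArg (fun u : E d => u j) hTv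
    simp at this
  exact ⟨j, (v a)⁻¹, by rw [hTv, smul_smul, inv_mul_cancel₀ hva0, one_smul]⟩

/-- Vertex interpolation on a common face does not depend on the reference coordinates. -/
theorem interp_comp_eq (hT : T '' cubeFace I₀ I₁ = cubeFace J₀ J₁) (c : E d → ℝ) {x : E d}
    (hx : x ∈ cubeFace I₀ I₁) :
    interp (fun e => c (T (corner e))) x = interp (fun e => c (corner e)) (T x) := by
  classical
  -- Projecting onto the affine hull of the face lets `G` be defined everywhere. It is then
  -- determined by its vertex values once it is known to be multiaffine.
  let P : (Fin d → ℝ) → E d := fun y =>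
    WithLp.toLp 2 fun i => if i ∈ I₀ then 0 else if i ∈ I₁ then 1 else y i
  have hP : ∀ y ∈ cubeFace I₀ I₁, P y = y := by
    intro y hy
    ext i
    simp only [P]
    split_ifs with h0 h1
    · exact (hy.2.1 i h0).symm
    · exact (hy.2.2 i h1).symm
    · rfl
  let G : (Fin d → ℝ) → ℝ := fun y => interp (fun e => c (corner e)) (T (P y))
  have hG : IsMultiaffine G := by
    intro y a
    by_cases ha : a ∈ I₀ ∨ a ∈ I₁
    · have : ∀ t, P (Function.update y a t) = P y := by
        intro t
        ext i
        simp only [P]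
        split_ifs with h0 h1
        · rfl
        · rfl
        · have : i ≠ a := by rintro rfl; tauto
          rw [Function.update_of_ne this]
      simp only [G, this]; ring
    · push Not at ha
      -- Varying `y a` changes a single coordinate of `T (P y)`, and it does so affinely.
      obtain ⟨j, r, hj⟩ := exists_linear_single_eq hT ⟨x, hx⟩ ha.1 ha.2
      have hPu : ∀ t, P (Function.update y a t)
          = (t - y a) • EuclideanSpace.single a (1 : ℝ) +ᵥ P y := by
        intro t
        ext i
        by_cases hi : i = a
        · subst hi; simp [P, ha]
        · simp [P, hi]
      have hTu : ∀ t, (T (P (Function.update y a t))).ofLp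
          = Function.update (T (P y)).ofLp j (T (P y) j + (t - y a) * r) := by
        intro t
        rw [hPu, T.map_vadd, map_smul, hj]
        ext i
        by_cases hi : i = j
        · subst hi; simp [add_comm]
        · simp [hi]
      have h1 := (isMultiaffine_interp fun e => c (corner e)).update_eq (T (P y)).ofLp j
      have h2 : G y = G (Function.update y a (y a)) := by rw [Function.update_eq_self]
      rw [h2]
      simp only [G, hTu]
      rw [h1 (_ + (y a - y a) * r), h1 (_ + (0 - y a) * r), h1 (_ + (1 - y a) * r)]
      ring
  have h := hG.eq_interp x
  simp only [G] at h
  rw [hP x hx] at h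
  rw [h]
  refine interp_congr_of_mem_cubeFace hx fun e he => ?_
  rw [hP _ he]
  obtain ⟨e', he'⟩ := exists_corner_eq (map_corner_eq_zero_or_one hT he)
  rw [← he', interp_corner]

end Gluing

end WaveCN

namespace WaveCN

/-! ### Geometry of elements and patches. -/

section UnitCube

variable {d : ℕ}

theorem unitCube_eq_preimage :
    unitCube d = (EuclideanSpace.equiv (Fin d) ℝ) ⁻¹' Set.pi Set.univ fun _ => Set.Icc (0 : ℝ) 1 := by
  ext x; simp [unitCube, Set.mem_pi, Set.mem_Icc, -Set.pi_univ_Icc]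

theorem isCompact_unitCube : IsCompact (unitCube d) := by
  rw [unitCube_eq_preimage]
  exact (EuclideanSpace.equiv (Fin d) ℝ).toHomeomorph.isClosedEmbedding.isCompact_preimage
    (isCompact_univ_pi fun _ => isCompact_Icc)

theorem convex_unitCube : Convex ℝ (unitCube d) := by
  rw [unitCube_eq_preimage]
  exact (convex_pi fun _ _ => convex_Icc _ _).linear_preimage
    (EuclideanSpace.equiv (Fin d) ℝ).toLinearMap

theorem interior_unitCube : interior (unitCube d) =
    (EuclideanSpace.equiv (Fin d) ℝ) ⁻¹' Set.pi Set.univ fun _ => Set.Ioo (0 : ℝ) 1 := by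
  rw [unitCube_eq_preimage]
  have := (EuclideanSpace.equiv (Fin d) ℝ).toHomeomorph.preimage_interior
    (Set.pi Set.univ fun _ => Set.Icc (0 : ℝ) 1)
  rw [interior_pi_set Set.finite_univ] at this
  simp only [interior_Icc] at this
  exact this.symm

theorem interior_unitCube_nonempty : (interior (unitCube d)).Nonempty := by
  rw [interior_unitCube]
  refine ⟨WithLp.toLp 2 fun _ => 1 / 2, fun i _ => ?_⟩
  norm_num

theorem disjoint_interior_unitCube_cubeFace {I₀ I₁ : Finset (Fin d)}
    (h : (I₀ ∪ I₁).Nonempty) {x : E d} (hx : x ∈ cubeFace I₀ I₁) : x ∉ interior (unitCube d) := by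
  intro hi
  rw [interior_unitCube] at hi
  obtain ⟨i, hI⟩ := h
  have h2 : 0 < x i ∧ x i < 1 := hi i (Set.mem_univ i)
  rcases Finset.mem_union.1 hI with h | h
  · exact h2.1.ne' (hx.2.1 i h)
  · exact h2.2.ne (hx.2.2 i h)

end UnitCube

namespace Mesh

variable {d : ℕ} {Ω : Set (E d)} (M : Mesh d Ω)

section Geometry

/-- The reference map of an element as a homeomorphism. -/
noncomputable def homeo (i : Fin M.card) : E d ≃ₜ E d :=
  (AffineEquiv.toContinuousAffineEquiv (M.map i)).toHomeomorph

theorem isCompact_elem (i : Fin M.card) : IsCompact (M.elem i) :=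
  isCompact_unitCube.image (M.homeo i).continuous

theorem isClosed_elem (i : Fin M.card) : IsClosed (M.elem i) := (M.isCompact_elem i).isClosed

theorem measurableSet_elem (i : Fin M.card) : MeasurableSet (M.elem i) :=
  (M.isClosed_elem i).measurableSet

theorem convex_elem (i : Fin M.card) : Convex ℝ (M.elem i) :=
  convex_unitCube.affine_image (M.map i).toAffineMap

theorem interior_elem (i : Fin M.card) : interior (M.elem i) = M.map i '' interior (unitCube d) :=
  ((M.homeo i).image_interior (unitCube d)).symm

theorem interior_elem_nonempty (i : Fin M.card) : (interior (M.elem i)).Nonempty := by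
  rw [interior_elem]
  exact interior_unitCube_nonempty.image _

theorem elem_nonempty (i : Fin M.card) : (M.elem i).Nonempty :=
  (M.interior_elem_nonempty i).mono interior_subset

theorem closure_interior_elem (i : Fin M.card) : closure (interior (M.elem i)) = M.elem i := by
  rw [(M.convex_elem i).closure_interior_eq_closure_of_nonempty_interior
    (M.interior_elem_nonempty i), (M.isClosed_elem i).closure_eq]

theorem volume_frontier_elem (i : Fin M.card) : volume (frontier (M.elem i)) = 0 :=
  (M.convex_elem i).addHaar_frontier volume

theorem ae_mem_interior_elem (i : Fin M.card) :
    ∀ᵐ x ∂volume.restrict (M.elem i), x ∈ interior (M.elem i) := by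
  rw [ae_restrict_iff' (M.measurableSet_elem i)]
  have h : ∀ᵐ x ∂(volume : Measure (E d)), x ∉ frontier (M.elem i) :=
    compl_mem_ae_iff.2 (M.volume_frontier_elem i)
  filter_upwards [h] with x hx hxi
  by_contra hc
  exact hx ⟨subset_closure hxi, hc⟩

theorem disjoint_interior_elem {i j : Fin M.card} (hij : i ≠ j) :
    Disjoint (interior (M.elem i)) (M.elem j) := by
  rw [← M.closure_interior_elem j]
  exact (M.interior_disjoint i j hij).closure_right isOpen_interior

theorem aedisjoint_elem {i j : Fin M.card} (hij : i ≠ j) :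
    AEDisjoint volume (M.elem i) (M.elem j) := by
  refine measure_mono_null ?_ (M.volume_frontier_elem i)
  intro x hx
  exact ⟨subset_closure hx.1, fun h => Set.disjoint_left.1 (M.disjoint_interior_elem hij) h hx.2⟩

theorem disjoint_interior_elemUnion {i : Fin M.card} {S : Finset (Fin M.card)} (hi : i ∉ S) :
    Disjoint (interior (M.elem i)) (M.elemUnion S) := by
  simp only [elemUnion, Set.disjoint_iUnion_right]
  intro j hj
  exact M.disjoint_interior_elem fun h => hi (h ▸ hj)

theorem iUnion_elem : ⋃ i, M.elem i = closure Ω := M.cover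

theorem elem_subset_closure (i : Fin M.card) : M.elem i ⊆ closure Ω :=
  M.iUnion_elem ▸ Set.subset_iUnion M.elem i

/-- The boundary lies in the union of the element frontiers, which are null by convexity. A boundary
point inside an element would lie on a face contained in the boundary; a proper face misses the
interior, and the improper face would give the boundary of an open set an interior point. -/
theorem volume_frontier_eq_zero (M : Mesh d Ω) (hΩ : IsOpen Ω) : volume (frontier Ω) = 0 := by
  refine measure_mono_null (t := ⋃ i, frontier (M.elem i)) ?_
    (measure_iUnion_null M.volume_frontier_elem)
  intro x hx
  have hx' : x ∈ ⋃ i, M.elem i := M.iUnion_elem ▸ frontier_subset_closure hx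
  obtain ⟨i, hi⟩ := Set.mem_iUnion.1 hx'
  refine Set.mem_iUnion.2 ⟨i, subset_closure hi, fun hint => ?_⟩
  obtain ⟨I₀, I₁, hxF, hF⟩ := M.boundary i x ⟨hi, hx⟩
  by_cases hne : (I₀ ∪ I₁).Nonempty
  · obtain ⟨y, hy, rfl⟩ := hxF
    rw [interior_elem] at hint
    obtain ⟨z, hz, hzy⟩ := hint
    rw [(M.map i).injective hzy] at hz
    exact disjoint_interior_unitCube_cubeFace hne hy hz
  · rw [Finset.not_nonempty_iff_eq_empty, Finset.union_eq_empty] at hne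
    have hall : M.elem i ⊆ frontier Ω := by
      refine subset_trans (Set.image_mono ?_) hF
      intro y hy
      exact ⟨hy, by simp [hne.1], by simp [hne.2]⟩
    have := interior_mono hall hint
    rw [← frontier_compl, interior_frontier hΩ.isClosed_compl] at this
    exact this

theorem isClosed_elemUnion (S : Finset (Fin M.card)) : IsClosed (M.elemUnion S) :=
  S.finite_toSet.isClosed_biUnion fun i _ => M.isClosed_elem i

theorem elem_subset_elemUnion {S : Finset (Fin M.card)} {i : Fin M.card} (hi : i ∈ S) :
    M.elem i ⊆ M.elemUnion S := Set.subset_biUnion_of_mem (u := M.elem) hi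

theorem closure_interior_elemUnion (S : Finset (Fin M.card)) :
    closure (interior (M.elemUnion S)) = M.elemUnion S := by
  refine (closure_minimal interior_subset (M.isClosed_elemUnion S)).antisymm ?_
  refine Set.iUnion₂_subset fun i hi => ?_
  rw [← M.closure_interior_elem i]
  exact closure_mono (interior_mono (M.elem_subset_elemUnion hi))

/-- The elements of the `ℓ`-th order element patch. -/
noncomputable def layer (S : Finset (Fin M.card)) : ℕ → Finset (Fin M.card)
  | 0 => S
  | ℓ + 1 => by
    classical
    exact Finset.univ.filter fun i => (M.elemUnion (layer S ℓ) ∩ M.elem i).Nonempty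

theorem mem_layer_succ {S : Finset (Fin M.card)} {ℓ : ℕ} {i : Fin M.card} :
    i ∈ M.layer S (ℓ + 1) ↔ (M.elemUnion (M.layer S ℓ) ∩ M.elem i).Nonempty := by
  simp [layer]

theorem layer_subset_succ (S : Finset (Fin M.card)) (ℓ : ℕ) :
    M.layer S ℓ ⊆ M.layer S (ℓ + 1) := by
  intro i hi
  rw [mem_layer_succ]
  obtain ⟨x, hx⟩ := M.elem_nonempty i
  exact ⟨x, M.elem_subset_elemUnion hi hx, hx⟩

theorem layer_zero_subset (S : Finset (Fin M.card)) (ℓ : ℕ) : S ⊆ M.layer S ℓ := by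
  induction ℓ with
  | zero => exact subset_rfl
  | succ ℓ ih => exact ih.trans (M.layer_subset_succ S ℓ)

theorem nbhd_eq {S : Finset (Fin M.card)} {ℓ : ℕ} {ω : Set (E d)}
    (h : closure ω = M.elemUnion (M.layer S ℓ)) :
    M.nbhd ω = interior (M.elemUnion (M.layer S (ℓ + 1))) := by
  unfold nbhd
  rw [h]
  congr 1
  exact Set.iUnion_congr fun i => Set.iUnion_congr_Prop M.mem_layer_succ.symm fun _ => rfl

/-- This makes the patches combinatorial: taking the interior loses no element, since a union of
closed elements is the closure of its interior. -/
theorem patch_eq (S : Finset (Fin M.card)) (ℓ : ℕ) :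
    M.patch (M.elemUnion S) ℓ = interior (M.elemUnion (M.layer S ℓ)) := by
  match ℓ with
  | 0 => rfl
  | 1 => exact M.nbhd_eq (ℓ := 0) (M.isClosed_elemUnion S).closure_eq
  | ℓ + 2 =>
    refine M.nbhd_eq (ℓ := ℓ + 1) ?_
    rw [patch_eq S (ℓ + 1), closure_interior_elemUnion]

end Geometry

/-! ### Finite element functions with prescribed vertex values; nodal truncation. -/

section Truncation

variable {M}

theorem eq_interp_of_mem_femSpace {u : E d → ℝ} (hu : u ∈ M.femSpace) (i : Fin M.card) {x : E d}
    (hx : x ∈ unitCube d) : u (M.map i x) = interp (fun e => u (M.map i (corner e))) x := by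
  obtain ⟨p, hp, hpe⟩ := hu.2.2 i
  rw [hpe x hx]
  have := (isMultiaffine_eval hp).eq_interp x
  rw [this]
  congr 1
  ext e
  exact (hpe _ (corner_mem_unitCube e)).symm

theorem continuous_interp (c : (Fin d → Bool) → ℝ) : Continuous fun x : E d => interp c x := by
  simp only [← eval_interpPoly]
  exact (MvPolynomial.continuous_eval _).comp (PiLp.continuous_ofLp 2 _)

variable (M)

/-- Vertex values that vanish on the boundary are the vertex values of a finite element function. -/
theorem exists_mem_femSpace (c : E d → ℝ) (hc : ∀ x ∉ Ω, c x = 0) (hΩ : IsOpen Ω) :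
    ∃ v ∈ M.femSpace, ∀ i e, v (M.map i (corner e)) = c (M.map i (corner e)) := by
  classical
  let q : Fin M.card → E d → ℝ := fun i x =>
    interp (fun e => c (M.map i (corner e))) ((M.map i).symm x)
  have hq : ∀ i j x, x ∈ M.elem i → x ∈ M.elem j → q i x = q j x := by
    intro i j x hi hj
    by_cases hij : i = j
    · rw [hij]
    obtain ⟨I₀, I₁, J₀, J₁, hF, hF'⟩ := M.conforming i j hij
    have hT : ((M.map i).trans (M.map j).symm) '' cubeFace I₀ I₁ = cubeFace J₀ J₁ := by
      rw [AffineEquiv.coe_trans, Set.image_comp, ← hF, hF', ← Set.image_comp]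
      simp
    have hx : x ∈ M.map i '' cubeFace I₀ I₁ := hF ▸ ⟨hi, hj⟩
    obtain ⟨y, hy, rfl⟩ := hx
    have := interp_comp_eq hT (fun z => c (M.map j z)) hy
    simpa [q] using this
  let v : E d → ℝ := fun x => if h : ∃ i, x ∈ M.elem i then q h.choose x else 0
  have hv : ∀ i x, x ∈ M.elem i → v x = q i x := by
    intro i x hx
    have h : ∃ i, x ∈ M.elem i := ⟨i, hx⟩
    simp only [v, dif_pos h]
    exact hq _ _ x h.choose_spec hx
  have hvc : ∀ i, ∀ x ∈ unitCube d,
      v (M.map i x) = interp (fun e => c (M.map i (corner e))) x := by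
    intro i x hx
    rw [hv i _ (Set.mem_image_of_mem _ hx)]
    simp [q]
  have hv0 : ∀ x ∉ Ω, v x = 0 := by
    intro x hx
    by_cases h : ∃ i, x ∈ M.elem i
    · obtain ⟨i, hi⟩ := h
      have hxf : x ∈ frontier Ω := by
        rw [hΩ.frontier_eq]; exact ⟨M.elem_subset_closure i hi, hx⟩
      obtain ⟨I₀, I₁, hxF, hF⟩ := M.boundary i x ⟨hi, hxf⟩
      rw [hv i x hi]
      obtain ⟨y, hy, rfl⟩ := hxF
      simp only [q, AffineEquiv.symm_apply_apply]
      -- All vertices of a boundary face lie outside the open set `Ω`, so the trace on that face is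
      -- zero.
      rw [interp_congr_of_mem_cubeFace hy (c' := 0)]
      · simp [interp]
      · intro e he
        refine hc _ fun hmem => ?_
        have := hF (Set.mem_image_of_mem _ he)
        rw [hΩ.frontier_eq] at this
        exact this.2 hmem
    · simp only [v, dif_neg h]
  refine ⟨v, ⟨?_, hv0, fun i => ⟨_, interpPoly_mem fun e => c (M.map i (corner e)), ?_⟩⟩, ?_⟩
  · let K : Option (Fin M.card) → Set (E d) := fun o => o.elim Ωᶜ M.elem
    refine (locallyFinite_of_finite K).continuous (Set.eq_univ_of_forall fun x => ?_) ?_ ?_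
    · by_cases hx : x ∈ Ω
      · have : x ∈ ⋃ i, M.elem i := M.iUnion_elem ▸ subset_closure hx
        obtain ⟨i, hi⟩ := Set.mem_iUnion.1 this
        exact Set.mem_iUnion.2 ⟨some i, hi⟩
      · exact Set.mem_iUnion.2 ⟨none, hx⟩
    · rintro (_ | i)
      · exact hΩ.isClosed_compl
      · exact M.isClosed_elem i
    · rintro (_ | i)
      · exact continuousOn_const.congr (fun x hx => hv0 x hx)
      · exact ((continuous_interp _).comp (M.homeo i).symm.continuous).continuousOn.congr
          (fun x hx => hv i x hx)
  · intro x hx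
    rw [hvc i x hx]
    exact (eval_interpPoly _ _).symm
  · intro i e
    rw [hvc i _ (corner_mem_unitCube e), interp_corner]

variable {M}

theorem eqOn_elem_of_corner {u v : E d → ℝ} (hu : u ∈ M.femSpace) (hv : v ∈ M.femSpace)
    {i : Fin M.card} (h : ∀ e, u (M.map i (corner e)) = v (M.map i (corner e))) :
    Set.EqOn u v (M.elem i) := by
  rintro _ ⟨x, hx, rfl⟩
  rw [eq_interp_of_mem_femSpace hu i hx, eq_interp_of_mem_femSpace hv i hx]
  simp only [h]

/-- The nodal truncation of a finite element function to the complement of a union of elements. -/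
theorem exists_truncation (hΩ : IsOpen Ω) {z : E d → ℝ} (hz : z ∈ M.femSpace)
    (S : Finset (Fin M.card)) (ℓ : ℕ) :
    ∃ v ∈ M.femSpace, (∀ i ∈ M.layer S ℓ, Set.EqOn v 0 (M.elem i)) ∧
      (∀ i ∉ M.layer S (ℓ + 1), Set.EqOn v z (M.elem i)) ∧
      ∀ i e, |v (M.map i (corner e))| ≤ |z (M.map i (corner e))| := by
  classical
  obtain ⟨v, hv, hvc⟩ := M.exists_mem_femSpace
    (fun x => if x ∈ M.elemUnion (M.layer S ℓ) then 0 else z x)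
    (fun x hx => by simp [hz.2.1 x hx]) hΩ
  have hcorner : ∀ i e, M.map i (corner e) ∈ M.elem i := fun i e =>
    Set.mem_image_of_mem _ (corner_mem_unitCube e)
  refine ⟨v, hv, fun i hi => ?_, fun i hi => ?_, fun i e => ?_⟩
  · refine eqOn_elem_of_corner hv M.femSpace.zero_mem fun e => ?_
    rw [hvc, if_pos (M.elem_subset_elemUnion hi (hcorner i e))]
    rfl
  · refine eqOn_elem_of_corner hv hz fun e => ?_
    -- An element outside the next layer does not touch the current one, so none of its vertex
    -- values was set to zero.
    rw [hvc, if_neg fun h => hi (M.mem_layer_succ.2 ⟨_, h, hcorner i e⟩)]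
  · rw [hvc]
    split_ifs <;> simp

end Truncation

end Mesh

end WaveCN

namespace WaveCN

/-! ### Scaling arguments: norm equivalence and inverse estimates. -/

section ReferenceEstimates

variable {d : ℕ}

theorem abs_shape_le_one (e : Fin d → Bool) {x : E d} (hx : x ∈ unitCube d) :
    |shape e x| ≤ 1 := by
  rw [shape, Finset.abs_prod]
  refine Finset.prod_le_one (fun i _ => abs_nonneg _) fun i _ => ?_
  have := hx i
  rw [abs_le]
  split_ifs <;> constructor <;> linarith [this.1, this.2]

theorem contDiff_shape (e : Fin d → Bool) : ContDiff ℝ 1 fun x : E d => shape e x := by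
  unfold shape
  refine contDiff_prod fun i _ => ?_
  split_ifs <;> fun_prop

theorem contDiff_interp (c : (Fin d → Bool) → ℝ) : ContDiff ℝ 1 fun x : E d => interp c x := by
  unfold interp
  exact ContDiff.sum fun e _ => contDiff_const.mul (contDiff_shape e)

theorem exists_abs_interp_le (d : ℕ) : ∃ κ : ℝ, 0 ≤ κ ∧
    ∀ (c : (Fin d → Bool) → ℝ), ∀ x ∈ unitCube d, |interp c x| ≤ κ * ‖c‖ := by
  refine ⟨Fintype.card (Fin d → Bool), Nat.cast_nonneg _, fun c x hx => ?_⟩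
  refine (Finset.abs_sum_le_sum_abs _ _).trans ?_
  rw [← nsmul_eq_mul, ← Finset.card_univ]
  refine Finset.sum_le_card_nsmul _ _ _ fun e _ => ?_
  rw [abs_mul]
  exact (mul_le_of_le_one_right (abs_nonneg _) (abs_shape_le_one e hx)).trans
    (norm_le_pi_norm c e)

theorem exists_interp_lipschitz (d : ℕ) : ∃ Λ : ℝ, 0 ≤ Λ ∧
    ∀ (c : (Fin d → Bool) → ℝ), ∀ x ∈ unitCube d, ∀ y ∈ unitCube d,
      |interp c x - interp c y| ≤ Λ * ‖c‖ * ‖x - y‖ := by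
  have h : ∀ e : Fin d → Bool, ∃ K, LipschitzOnWith K (fun x : E d => shape e x) (unitCube d) :=
    fun e => (contDiff_shape e).contDiffOn.exists_lipschitzOnWith one_ne_zero
      convex_unitCube isCompact_unitCube
  choose K hK using h
  refine ⟨∑ e, (K e : ℝ), Finset.sum_nonneg fun e _ => (K e).2, fun c x hx y hy => ?_⟩
  simp only [interp, ← Finset.sum_sub_distrib, Finset.sum_mul]
  refine (Finset.abs_sum_le_sum_abs _ _).trans (Finset.sum_le_sum fun e _ => ?_)
  rw [← mul_sub, abs_mul, mul_comm (K e : ℝ), mul_assoc]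
  refine mul_le_mul (norm_le_pi_norm c e) ?_ (abs_nonneg _) (norm_nonneg _)
  have := (hK e).dist_le_mul x hx y hy
  rwa [Real.dist_eq, dist_eq_norm] at this

theorem memLp_interp (c : (Fin d → Bool) → ℝ) :
    MemLp (fun x : E d => interp c x) 2 (volume.restrict (unitCube d)) := by
  have : IsFiniteMeasure (volume.restrict (unitCube d)) :=
    ⟨by simpa using isCompact_unitCube.measure_lt_top⟩
  obtain ⟨κ, -, hκ⟩ := exists_abs_interp_le d
  refine MemLp.of_bound (Mesh.continuous_interp c).aestronglyMeasurable (κ * ‖c‖) ?_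
  exact ae_restrict_of_forall_mem isCompact_unitCube.measurableSet fun x hx => hκ c x hx

theorem interp_add (c c' : (Fin d → Bool) → ℝ) (x : Fin d → ℝ) :
    interp (c + c') x = interp c x + interp c' x := by
  simp [interp, add_mul, Finset.sum_add_distrib]

theorem interp_smul (r : ℝ) (c : (Fin d → Bool) → ℝ) (x : Fin d → ℝ) :
    interp (r • c) x = r * interp c x := by
  simp [interp, mul_assoc, Finset.mul_sum]

/-- Interpolation of vertex values as a map into `L²` of the reference cube. -/
noncomputable def interpLp (d : ℕ) :
    ((Fin d → Bool) → ℝ) →ₗ[ℝ] Lp ℝ 2 (volume.restrict (unitCube d)) where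
  toFun c := (memLp_interp c).toLp _
  map_add' c c' := by
    rw [← MemLp.toLp_add]
    exact MemLp.toLp_congr _ _ (.of_forall fun x => interp_add c c' x)
  map_smul' r c := by
    rw [RingHom.id_apply, ← MemLp.toLp_const_smul]
    exact MemLp.toLp_congr _ _ (.of_forall fun x => interp_smul r c x)

/-- A continuous function that vanishes almost everywhere on the cube vanishes up to the vertices,
because the cube is the closure of its interior. -/
theorem ker_interpLp : LinearMap.ker (interpLp d) = ⊥ := by
  refine LinearMap.ker_eq_bot'.2 fun c hc => ?_
  have h1 : (fun x : E d => interp c x) =ᵐ[volume.restrict (unitCube d)] fun _ => 0 := by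
    refine (memLp_interp c).coeFn_toLp.symm.trans ?_
    change ⇑(interpLp d c) =ᵐ[_] _
    rw [hc]
    exact Lp.coeFn_zero _ _ _
  have h2 := Measure.eqOn_of_ae_eq h1 (Mesh.continuous_interp c).continuousOn
    continuousOn_const (by
      rw [convex_unitCube.closure_interior_eq_closure_of_nonempty_interior
        interior_unitCube_nonempty]
      exact subset_closure)
  ext e
  have := h2 (corner_mem_unitCube e)
  simpa [interp_corner] using this

/-- An injective linear map on a finite-dimensional space is bounded below. The norm of `c` is the
maximum norm of the vertex values. -/
theorem exists_norm_sq_le_integral (d : ℕ) : ∃ κ : ℝ, 0 ≤ κ ∧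
    ∀ c : (Fin d → Bool) → ℝ, ‖c‖ ^ 2 ≤ κ * ∫ x in unitCube d, interp c x * interp c x := by
  obtain ⟨K, -, hK⟩ := (interpLp d).exists_antilipschitzWith ker_interpLp
  refine ⟨(K : ℝ) ^ 2, sq_nonneg _, fun c => ?_⟩
  have h1 : ‖c‖ ≤ K * ‖interpLp d c‖ := by
    have := hK.le_mul_dist c 0
    simpa [dist_eq_norm] using this
  have h2 : ‖interpLp d c‖ ^ 2 = ∫ x in unitCube d, interp c x * interp c x := by
    rw [← real_inner_self_eq_norm_sq, L2.inner_def]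
    refine integral_congr_ae ?_
    filter_upwards [(memLp_interp c).coeFn_toLp] with x hx
    change inner ℝ ((memLp_interp c).toLp _ x) ((memLp_interp c).toLp _ x) = _
    rw [hx]
    rfl
  rw [← h2, ← mul_pow]
  exact pow_le_pow_left₀ (norm_nonneg _) h1 2

/-- Transformation of integrals over a parallelepiped to the reference cube. -/
theorem exists_integral_image_eq (T : E d ≃ᵃ[ℝ] E d) : ∃ D : ℝ, 0 ≤ D ∧
    ∀ g : E d → ℝ, ∫ x in T '' unitCube d, g x = D * ∫ x in unitCube d, g (T x) := by
  let L : E d →L[ℝ] E d := LinearMap.toContinuousLinearMap (T.linear : E d →ₗ[ℝ] E d)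
  refine ⟨|L.det|, abs_nonneg _, fun g => ?_⟩
  have hT : ∀ x, T x = L x + T 0 := by
    intro x
    have := T.map_vadd 0 x
    simp only [vadd_eq_add, add_zero] at this
    exact this
  have hd : ∀ x ∈ unitCube d, HasFDerivWithinAt T L (unitCube d) x := by
    intro x _
    have := (L.hasFDerivWithinAt (s := unitCube d) (x := x)).add_const (T 0)
    exact this.congr (fun y _ => hT y) (hT x)
  rw [integral_image_eq_integral_abs_det_fderiv_smul volume isCompact_unitCube.measurableSet hd
    T.injective.injOn]
  simp only [smul_eq_mul]
  rw [integral_const_mul]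

/-- The inverse map sends a ball of radius `r` into the cube, so its linear part has norm at most
the diameter of the cube divided by `r`. -/
theorem exists_norm_symm_sub_le (d : ℕ) : ∃ D : ℝ, 0 ≤ D ∧
    ∀ (T : E d ≃ᵃ[ℝ] E d) (x₀ : E d) (r : ℝ), 0 < r →
      Metric.closedBall x₀ r ⊆ T '' unitCube d →
      ∀ x y, ‖T.symm x - T.symm y‖ ≤ D / r * ‖x - y‖ := by
  obtain ⟨D, hD⟩ := Metric.isBounded_iff.1 (isCompact_unitCube (d := d)).isBounded
  have hD0 : 0 ≤ D := dist_nonneg.trans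
    (hD (corner_mem_unitCube fun _ => true) (corner_mem_unitCube fun _ => true))
  refine ⟨D, hD0, fun T x₀ r hr hB x y => ?_⟩
  have hsub : T.symm x - T.symm y = T.symm.linear (x - y) := by
    have := T.symm.toAffineMap.linearMap_vsub x y
    simpa using this.symm
  rw [hsub]
  by_cases hxy : x - y = 0
  · simp [hxy]
  have hn : 0 < ‖x - y‖ := norm_pos_iff.2 hxy
  set w := (r / ‖x - y‖) • (x - y) with hw
  have hwn : ‖w‖ = r := by
    rw [hw, norm_smul, Real.norm_of_nonneg (by positivity)]
    field_simp
  have hmem : ∀ p ∈ Metric.closedBall x₀ r, T.symm p ∈ unitCube d := by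
    intro p hp
    obtain ⟨q, hq, rfl⟩ := hB hp
    simpa using hq
  have h1 := hD (hmem (w +ᵥ x₀) (by simp [hwn])) (hmem x₀ (by simp [hr.le]))
  rw [T.symm.map_vadd, dist_eq_norm, vadd_eq_add, add_sub_cancel_right, hw, map_smul, norm_smul,
    Real.norm_of_nonneg (by positivity)] at h1
  rw [div_mul_eq_mul_div, le_div_iff₀ hr]
  rw [div_mul_eq_mul_div, div_le_iff₀ hn] at h1
  linarith

end ReferenceEstimates

namespace Mesh

variable {d : ℕ} {Ω : Set (E d)} {M : Mesh d Ω}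

/-- The vertex values of a function on an element. -/
noncomputable def vertexValues (M : Mesh d Ω) (i : Fin M.card) (u : E d → ℝ) : (Fin d → Bool) → ℝ :=
  fun e => u (M.map i (corner e))

theorem eqOn_interp {u : E d → ℝ} (hu : u ∈ M.femSpace) (i : Fin M.card) :
    Set.EqOn u (fun x => interp (M.vertexValues i u) ((M.map i).symm x)) (M.elem i) := by
  rintro _ ⟨x, hx, rfl⟩
  simp only [AffineEquiv.symm_apply_apply]
  exact eq_interp_of_mem_femSpace hu i hx

theorem differentiableAt_of_mem_interior {u : E d → ℝ} (hu : u ∈ M.femSpace) {i : Fin M.card}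
    {x : E d} (hx : x ∈ interior (M.elem i)) : DifferentiableAt ℝ u x := by
  have h : u =ᶠ[nhds x] fun x => interp (M.vertexValues i u) ((M.map i).symm x) :=
    Filter.eventuallyEq_of_mem (mem_interior_iff_mem_nhds.1 hx) (eqOn_interp hu i)
  refine DifferentiableAt.congr_of_eventuallyEq ?_ h
  have h1 : Differentiable ℝ fun x : E d => interp (M.vertexValues i u) x :=
    (contDiff_interp _).differentiable one_ne_zero
  have h2 : Differentiable ℝ fun x => (M.map i).symm x :=
    (AffineEquiv.toContinuousAffineEquiv (M.map i).symm).toContinuousAffineMap.differentiable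
  exact (h1.comp h2) x

theorem norm_gradient (u : E d → ℝ) (x : E d) : ‖gradient u x‖ = ‖fderiv ℝ u x‖ := by
  simp [gradient]

theorem gradient_add {u v : E d → ℝ} {x : E d} (hu : DifferentiableAt ℝ u x)
    (hv : DifferentiableAt ℝ v x) : gradient (u + v) x = gradient u x + gradient v x := by
  simp [gradient, fderiv_add hu hv]

theorem gradient_smul {u : E d → ℝ} {x : E d} (hu : DifferentiableAt ℝ u x) (r : ℝ) :
    gradient (r • u) x = r • gradient u x := by
  simp [gradient, fderiv_const_smul hu r]

theorem gradient_eq_of_eqOn {u v : E d → ℝ} {K : Set (E d)} (h : Set.EqOn u v K) {x : E d}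
    (hx : x ∈ interior K) : gradient u x = gradient v x := by
  have : u =ᶠ[nhds x] v := Filter.eventuallyEq_of_mem (mem_interior_iff_mem_nhds.1 hx) h
  simp [gradient, this.fderiv_eq]

theorem measurable_gradient (u : E d → ℝ) : Measurable (gradient u) :=
  (InnerProductSpace.toDual ℝ (E d)).symm.continuous.measurable.comp (measurable_fderiv ℝ u)

/-- Local stability of vertex-wise reductions and the inverse inequality, up to constants that
depend on the dimension and on the shape regularity only. -/
theorem exists_element_constants (d : ℕ) (σ : ℝ) (hσ : 0 < σ) : ∃ c : ℝ, 0 ≤ c ∧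
    ∀ (Ω : Set (E d)) (M : Mesh d Ω) (h : ℝ), 0 < h → M.IsQuasiUniform σ h →
    ∀ (i : Fin M.card) (v z : E d → ℝ), v ∈ M.femSpace → z ∈ M.femSpace →
      (∀ e, |v (M.map i (corner e))| ≤ |z (M.map i (corner e))|) →
      ∃ b : ℝ, 0 ≤ b ∧ volume.real (M.elem i) * b ≤ c * ∫ x in M.elem i, z x * z x ∧
        (∀ x ∈ M.elem i, v x * v x ≤ b) ∧
        ∀ x ∈ interior (M.elem i), ‖gradient v x‖ ^ 2 ≤ b / h ^ 2 := by
  obtain ⟨κ₁, hκ₁, h₁⟩ := exists_abs_interp_le d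
  obtain ⟨Λ, hΛ, h₂⟩ := exists_interp_lipschitz d
  obtain ⟨κ, hκ, h₃⟩ := exists_norm_sq_le_integral d
  obtain ⟨D, hD, h₄⟩ := exists_norm_symm_sub_le d
  -- The first summand serves the pointwise bound of `v`, the second the bound of its gradient.
  set a := κ₁ ^ 2 + (Λ * (D * σ)) ^ 2 with ha
  have ha0 : 0 ≤ a := by positivity
  refine ⟨a * (volume.real (unitCube d) * κ), by positivity, ?_⟩
  intro Ω M h hh hq i v z hv hz hvz
  have hle : ‖M.vertexValues i v‖ ≤ ‖M.vertexValues i z‖ :=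
    (pi_norm_le_iff_of_nonneg (norm_nonneg _)).2 fun e =>
      (hvz e).trans (norm_le_pi_norm (M.vertexValues i z) e)
  set n := ‖M.vertexValues i z‖ with hn
  have hn0 : 0 ≤ n := norm_nonneg _
  refine ⟨a * n ^ 2, by positivity, ?_, ?_, ?_⟩
  -- Volume and integral scale with the same Jacobian `J`, so it does not enter the constant.
  · obtain ⟨J, hJ, hint⟩ := exists_integral_image_eq (M.map i)
    have e1 : volume.real (M.elem i) = J * volume.real (unitCube d) := by
      have := hint fun _ => 1
      simpa [elem] using this
    have e2 : ∫ x in M.elem i, z x * z x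
        = J * ∫ x in unitCube d, interp (M.vertexValues i z) x * interp (M.vertexValues i z) x := by
      rw [elem, hint]
      congr 1
      refine setIntegral_congr_fun isCompact_unitCube.measurableSet fun x hx => ?_
      simp only [eq_interp_of_mem_femSpace hz i hx]
      rfl
    rw [e1, e2]
    have h5 := h₃ (M.vertexValues i z)
    calc J * volume.real (unitCube d) * (a * n ^ 2)
        = J * volume.real (unitCube d) * a * n ^ 2 := by ring
      _ ≤ J * volume.real (unitCube d) * a * _ :=
        mul_le_mul_of_nonneg_left h5 (by positivity)
      _ = _ := by ring
  · intro x hx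
    rw [eqOn_interp hv i hx]
    have hx' : (M.map i).symm x ∈ unitCube d := by
      obtain ⟨y, hy, rfl⟩ := hx; simpa using hy
    have h5 : |interp (M.vertexValues i v) ((M.map i).symm x)| ≤ κ₁ * n :=
      (h₁ _ _ hx').trans (by gcongr)
    have h6 := pow_le_pow_left₀ (abs_nonneg _) h5 2
    rw [sq_abs] at h6
    have : (κ₁ * n) ^ 2 ≤ a * n ^ 2 := by
      rw [mul_pow]
      gcongr
      rw [ha]
      linarith [sq_nonneg (Λ * (D * σ))]
    linarith [h6, sq (interp (M.vertexValues i v) ((M.map i).symm x))]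
  · intro x hx
    obtain ⟨x₀, hB⟩ := (hq i).2
    have h5 := h₄ (M.map i) x₀ (h / σ) (by positivity) hB
    have hR : D / (h / σ) = D * σ / h := by field_simp
    rw [hR] at h5
    have hlip : LipschitzOnWith (Real.toNNReal (Λ * n * (D * σ / h))) v (M.elem i) := by
      refine LipschitzOnWith.of_dist_le_mul fun p hp q hq' => ?_
      rw [Real.coe_toNNReal _ (by positivity), Real.dist_eq, dist_eq_norm, eqOn_interp hv i hp,
        eqOn_interp hv i hq']
      have hp' : (M.map i).symm p ∈ unitCube d := by
        obtain ⟨y, hy, rfl⟩ := hp; simpa using hy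
      have hq'' : (M.map i).symm q ∈ unitCube d := by
        obtain ⟨y, hy, rfl⟩ := hq'; simpa using hy
      refine (h₂ _ _ hp' _ hq'').trans ?_
      rw [mul_assoc _ (D * σ / h)]
      exact mul_le_mul (by gcongr) (h5 p q) (norm_nonneg _) (by positivity)
    have h6 := norm_fderiv_le_of_lipschitzOn ℝ (mem_interior_iff_mem_nhds.1 hx) hlip
    rw [Real.coe_toNNReal _ (by positivity), ← norm_gradient] at h6
    refine (pow_le_pow_left₀ (norm_nonneg _) h6 2).trans ?_
    have e : (Λ * n * (D * σ / h)) ^ 2 = (Λ * (D * σ)) ^ 2 * n ^ 2 / h ^ 2 := by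
      field_simp
    rw [e]
    gcongr
    rw [ha]
    linarith [sq_nonneg κ₁]

end Mesh

end WaveCN

namespace WaveCN

/-! ### Splitting integrals and forms over the elements. -/

namespace Mesh

variable {d : ℕ} {Ω : Set (E d)} (M : Mesh d Ω)

theorem diff_interior_elemUnion_ae_eq (hΩ : IsOpen Ω) (L : Finset (Fin M.card)) :
    (Ω \ interior (M.elemUnion L) : Set (E d)) =ᵐ[volume] M.elemUnion Lᶜ := by
  have h1 : ∀ᵐ x ∂(volume : Measure (E d)), ∀ i, x ∉ frontier (M.elem i) :=
    ae_all_iff.2 fun i => compl_mem_ae_iff.2 (M.volume_frontier_elem i)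
  have h2 : ∀ᵐ x ∂(volume : Measure (E d)), x ∉ frontier Ω :=
    compl_mem_ae_iff.2 (M.volume_frontier_eq_zero hΩ)
  filter_upwards [h1, h2] with x hx1 hx2
  have hint : ∀ i, x ∈ M.elem i → x ∈ interior (M.elem i) := fun i hi => by
    by_contra hc
    exact hx1 i ⟨subset_closure hi, hc⟩
  refine propext ⟨fun hx => ?_, fun hx => ?_⟩
  · have hx' : x ∈ ⋃ i, M.elem i := M.iUnion_elem ▸ subset_closure hx.1
    obtain ⟨i, hi⟩ := Set.mem_iUnion.1 hx'
    refine M.elem_subset_elemUnion (S := Lᶜ) (Finset.mem_compl.2 fun hL => hx.2 ?_) hi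
    exact interior_mono (M.elem_subset_elemUnion hL) (hint i hi)
  · obtain ⟨i, hL, hi⟩ := Set.mem_iUnion₂.1 hx
    refine ⟨?_, fun hc => ?_⟩
    · by_contra hc
      exact hx2 (hΩ.frontier_eq ▸ ⟨M.elem_subset_closure i hi, hc⟩)
    · exact Set.disjoint_left.1 (M.disjoint_interior_elemUnion (Finset.mem_compl.1 hL))
        (hint i hi) (interior_subset hc)

theorem ae_eq_elemUnion_univ (hΩ : IsOpen Ω) :
    (Ω : Set (E d)) =ᵐ[volume] M.elemUnion Finset.univ := by
  have := M.diff_interior_elemUnion_ae_eq hΩ ∅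
  simpa [elemUnion] using this

theorem restrict_elem_le (hΩ : IsOpen Ω) (i : Fin M.card) :
    volume.restrict (M.elem i) ≤ volume.restrict Ω := by
  rw [Measure.restrict_congr_set (M.ae_eq_elemUnion_univ hΩ)]
  exact Measure.restrict_mono (M.elem_subset_elemUnion (Finset.mem_univ i)) le_rfl

theorem ae_exists_mem_interior (hΩ : IsOpen Ω) :
    ∀ᵐ x ∂volume.restrict Ω, ∃ i, x ∈ interior (M.elem i) := by
  rw [Measure.restrict_congr_set (M.ae_eq_elemUnion_univ hΩ), elemUnion,
    ae_restrict_biUnion_finset_iff]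
  intro i _
  filter_upwards [M.ae_mem_interior_elem i] with x hx
  exact ⟨i, hx⟩

theorem integral_elemUnion (T : Finset (Fin M.card)) {f : E d → ℝ}
    (hf : ∀ i, IntegrableOn f (M.elem i)) :
    ∫ x in M.elemUnion T, f x = ∑ i ∈ T, ∫ x in M.elem i, f x := by
  have : M.elemUnion T = ⋃ i : T, M.elem i := by
    ext x; simp [elemUnion]
  rw [this, integral_iUnion_ae (s := fun i : T => M.elem i) (fun i => (M.measurableSet_elem i).nullMeasurableSet)
    (fun i j hij => M.aedisjoint_elem fun h => hij (Subtype.ext h))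
    (integrableOn_finite_iUnion.2 fun i => hf i), tsum_fintype]
  exact Finset.sum_coe_sort T fun i => ∫ x in M.elem i, f x

theorem integral_domain (hΩ : IsOpen Ω) {f : E d → ℝ} (hf : ∀ i, IntegrableOn f (M.elem i)) :
    ∫ x in Ω, f x = ∑ i, ∫ x in M.elem i, f x := by
  rw [setIntegral_congr_set (M.ae_eq_elemUnion_univ hΩ), M.integral_elemUnion _ hf]

theorem integrableOn_domain (hΩ : IsOpen Ω) {f : E d → ℝ}
    (hf : ∀ i, IntegrableOn f (M.elem i)) : IntegrableOn f Ω := by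
  rw [integrableOn_congr_set_ae (M.ae_eq_elemUnion_univ hΩ)]
  exact integrableOn_finset_iUnion.2 fun i _ => hf i

end Mesh

/-- The standing assumptions on the domain, the coefficient and the mesh. -/
structure IsAdmissible {d : ℕ} {Ω : Set (E d)} (M : Mesh d Ω) (A : E d → ℝ)
    (σ α β h : ℝ) : Prop where
  isOpen : IsOpen Ω
  aemeasurable : AEMeasurable A (volume.restrict Ω)
  bounds : ∀ᵐ x ∂volume.restrict Ω, α ≤ A x ∧ A x ≤ β
  lower_pos : 0 < α
  le : α ≤ β
  reg_pos : 0 < σ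
  size_pos : 0 < h
  quasiUniform : M.IsQuasiUniform σ h

namespace IsAdmissible

variable {d : ℕ} {Ω : Set (E d)} {M : Mesh d Ω} {A : E d → ℝ} {σ α β h : ℝ}

theorem upper_pos (H : IsAdmissible M A σ α β h) : 0 < β := H.lower_pos.trans_le H.le

theorem ae_elem (H : IsAdmissible M A σ α β h) (i : Fin M.card) :
    ∀ᵐ x ∂volume.restrict (M.elem i), 0 ≤ A x ∧ A x ≤ β := by
  have := (Measure.absolutelyContinuous_of_le (M.restrict_elem_le H.isOpen i)).ae_le H.bounds
  filter_upwards [this] with x hx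
  exact ⟨H.lower_pos.le.trans hx.1, hx.2⟩

theorem integrableOn_mul {u v : E d → ℝ} (hu : u ∈ M.femSpace) (hv : v ∈ M.femSpace)
    (i : Fin M.card) : IntegrableOn (fun x => u x * v x) (M.elem i) :=
  (hu.1.mul hv.1).continuousOn.integrableOn_compact (M.isCompact_elem i)

theorem exists_norm_gradient_le (H : IsAdmissible M A σ α β h) {u : E d → ℝ}
    (hu : u ∈ M.femSpace) (i : Fin M.card) :
    ∃ b : ℝ, 0 ≤ b ∧ ∀ x ∈ interior (M.elem i), ‖gradient u x‖ ≤ b := by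
  obtain ⟨c, -, hc⟩ := Mesh.exists_element_constants d σ H.reg_pos
  obtain ⟨b, -, -, -, hb⟩ := hc Ω M h H.size_pos H.quasiUniform i u u hu hu fun _ => le_rfl
  exact ⟨_, Real.sqrt_nonneg _, fun x hx => Real.le_sqrt_of_sq_le (hb x hx)⟩

theorem integrableOn_inner (H : IsAdmissible M A σ α β h) {u v : E d → ℝ}
    (hu : u ∈ M.femSpace) (hv : v ∈ M.femSpace) (i : Fin M.card) :
    IntegrableOn (fun x => inner ℝ (gradient u x) (gradient v x)) (M.elem i) := by
  obtain ⟨a, ha, hua⟩ := H.exists_norm_gradient_le hu i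
  obtain ⟨b, hb, hvb⟩ := H.exists_norm_gradient_le hv i
  have : IsFiniteMeasure (volume.restrict (M.elem i)) :=
    ⟨by simpa using (M.isCompact_elem i).measure_lt_top⟩
  refine Integrable.of_bound ((Mesh.measurable_gradient u).inner
    (Mesh.measurable_gradient v)).aestronglyMeasurable (a * b) ?_
  filter_upwards [M.ae_mem_interior_elem i] with x hx
  exact (norm_inner_le_norm _ _).trans
    (mul_le_mul (hua x hx) (hvb x hx) (norm_nonneg _) ha)

theorem integrableOn_coeff (H : IsAdmissible M A σ α β h) {u v : E d → ℝ}
    (hu : u ∈ M.femSpace) (hv : v ∈ M.femSpace) (i : Fin M.card) :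
    IntegrableOn (fun x => A x * inner ℝ (gradient u x) (gradient v x)) (M.elem i) := by
  refine (H.integrableOn_inner hu hv i).bdd_mul (c := β)
    (H.aemeasurable.mono_measure (M.restrict_elem_le H.isOpen i)).aestronglyMeasurable ?_
  filter_upwards [H.ae_elem i] with x hx
  rw [Real.norm_of_nonneg hx.1]
  exact hx.2

theorem l2_domain (H : IsAdmissible M A σ α β h) {u v : E d → ℝ}
    (hu : u ∈ M.femSpace) (hv : v ∈ M.femSpace) :
    l2 Ω u v = ∑ i, l2 (M.elem i) u v :=
  M.integral_domain H.isOpen (integrableOn_mul hu hv)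

theorem aForm_domain (H : IsAdmissible M A σ α β h) {u v : E d → ℝ}
    (hu : u ∈ M.femSpace) (hv : v ∈ M.femSpace) :
    aForm A Ω u v = ∑ i, aForm A (M.elem i) u v :=
  M.integral_domain H.isOpen (H.integrableOn_coeff hu hv)

theorem l2_add_left (H : IsAdmissible M A σ α β h) {u w v : E d → ℝ}
    (hu : u ∈ M.femSpace) (hw : w ∈ M.femSpace) (hv : v ∈ M.femSpace) :
    l2 Ω (u + w) v = l2 Ω u v + l2 Ω w v := by
  simp only [l2, Pi.add_apply, add_mul]
  exact integral_add (M.integrableOn_domain H.isOpen (integrableOn_mul hu hv))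
    (M.integrableOn_domain H.isOpen (integrableOn_mul hw hv))

theorem l2_smul_left (r : ℝ) (u v : E d → ℝ) : l2 Ω (r • u) v = r * l2 Ω u v := by
  simp only [l2, Pi.smul_apply, smul_eq_mul, mul_assoc]
  exact integral_const_mul _ _

theorem aForm_add_left (H : IsAdmissible M A σ α β h) {u w v : E d → ℝ}
    (hu : u ∈ M.femSpace) (hw : w ∈ M.femSpace) (hv : v ∈ M.femSpace) :
    aForm A Ω (u + w) v = aForm A Ω u v + aForm A Ω w v := by
  have h1 : aForm A Ω (u + w) v = ∫ x in Ω, (A x * inner ℝ (gradient u x) (gradient v x)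
      + A x * inner ℝ (gradient w x) (gradient v x)) := by
    refine integral_congr_ae ?_
    filter_upwards [M.ae_exists_mem_interior H.isOpen] with x ⟨i, hx⟩
    rw [Mesh.gradient_add (Mesh.differentiableAt_of_mem_interior hu hx)
      (Mesh.differentiableAt_of_mem_interior hw hx), inner_add_left, mul_add]
  rw [h1]
  exact integral_add (M.integrableOn_domain H.isOpen (H.integrableOn_coeff hu hv))
    (M.integrableOn_domain H.isOpen (H.integrableOn_coeff hw hv))

theorem aForm_smul_left (H : IsAdmissible M A σ α β h) (r : ℝ) {u : E d → ℝ}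
    (hu : u ∈ M.femSpace) (v : E d → ℝ) : aForm A Ω (r • u) v = r * aForm A Ω u v := by
  have h1 : aForm A Ω (r • u) v
      = ∫ x in Ω, r * (A x * inner ℝ (gradient u x) (gradient v x)) := by
    refine integral_congr_ae ?_
    filter_upwards [M.ae_exists_mem_interior H.isOpen] with x ⟨i, hx⟩
    rw [Mesh.gradient_smul (Mesh.differentiableAt_of_mem_interior hu hx), inner_smul_left]
    simp only [conj_trivial]
    ring
  rw [h1]
  exact integral_const_mul _ _

end IsAdmissible

/-! ### Young inequalities and the local bound of the forms. -/

section Elementwise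

variable {d : ℕ} {Ω : Set (E d)} {M : Mesh d Ω} {A : E d → ℝ} {σ α β h : ℝ}

theorem l2_congr {K : Set (E d)} (hK : MeasurableSet K) {u u' v v' : E d → ℝ}
    (hu : Set.EqOn u u' K) (hv : Set.EqOn v v' K) : l2 K u v = l2 K u' v' :=
  setIntegral_congr_fun hK fun x hx => by simp only [hu hx, hv hx]

theorem aForm_congr (i : Fin M.card) {u u' v v' : E d → ℝ}
    (hu : Set.EqOn u u' (interior (M.elem i))) (hv : Set.EqOn v v' (M.elem i)) :
    aForm A (M.elem i) u v = aForm A (M.elem i) u' v' := by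
  refine integral_congr_ae ?_
  filter_upwards [M.ae_mem_interior_elem i] with x hx
  rw [Mesh.gradient_eq_of_eqOn hu (by rwa [interior_interior]), Mesh.gradient_eq_of_eqOn hv hx]

theorem gradient_zero (x : E d) : gradient (0 : E d → ℝ) x = 0 := by
  simp [gradient]

theorem l2_zero_right (K : Set (E d)) (u : E d → ℝ) : l2 K u 0 = 0 := by simp [l2]

theorem l2_zero_left (K : Set (E d)) (u : E d → ℝ) : l2 K 0 u = 0 := by simp [l2]

theorem aForm_zero_right (K : Set (E d)) (u : E d → ℝ) : aForm A K u 0 = 0 := by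
  simp [aForm, gradient_zero]

theorem aForm_zero_left (K : Set (E d)) (u : E d → ℝ) : aForm A K 0 u = 0 := by
  simp [aForm, gradient_zero]

theorem l2_self_nonneg (K : Set (E d)) (u : E d → ℝ) : 0 ≤ l2 K u u :=
  integral_nonneg fun x => mul_self_nonneg (u x)

theorem aForm_self_nonneg (H : IsAdmissible M A σ α β h) (i : Fin M.card) (u : E d → ℝ) :
    0 ≤ aForm A (M.elem i) u u := by
  refine integral_nonneg_of_ae ?_
  filter_upwards [H.ae_elem i] with x hx
  exact mul_nonneg hx.1 real_inner_self_nonneg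

theorem abs_l2_le {u v : E d → ℝ} (hu : u ∈ M.femSpace) (hv : v ∈ M.femSpace) (i : Fin M.card)
    {δ : ℝ} (hδ : 0 < δ) : |l2 (M.elem i) u v|
      ≤ 1 / (2 * δ) * l2 (M.elem i) u u + δ / 2 * l2 (M.elem i) v v := by
  unfold l2
  rw [← integral_const_mul, ← integral_const_mul, ← integral_add, ← Real.norm_eq_abs]
  · refine norm_integral_le_of_norm_le ?_ (.of_forall fun x => ?_)
    · exact ((IsAdmissible.integrableOn_mul hu hu i).const_mul _).add
        ((IsAdmissible.integrableOn_mul hv hv i).const_mul _)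
    · rw [Real.norm_eq_abs, abs_le]
      have h1 : 1 / (2 * δ) * (u x * u x) + δ / 2 * (v x * v x) - u x * v x
          = (u x - δ * v x) ^ 2 / (2 * δ) := by field_simp; ring
      have h2 : 1 / (2 * δ) * (u x * u x) + δ / 2 * (v x * v x) + u x * v x
          = (u x + δ * v x) ^ 2 / (2 * δ) := by field_simp; ring
      have h3 : 0 ≤ (u x - δ * v x) ^ 2 / (2 * δ) := by positivity
      have h4 : 0 ≤ (u x + δ * v x) ^ 2 / (2 * δ) := by positivity
      constructor <;> linarith
  · exact (IsAdmissible.integrableOn_mul hu hu i).const_mul _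
  · exact (IsAdmissible.integrableOn_mul hv hv i).const_mul _

theorem abs_inner_le (p q : E d) {δ : ℝ} (hδ : 0 < δ) :
    |inner ℝ p q| ≤ 1 / (2 * δ) * inner ℝ p p + δ / 2 * inner ℝ q q := by
  refine (abs_real_inner_le_norm p q).trans ?_
  rw [real_inner_self_eq_norm_sq, real_inner_self_eq_norm_sq]
  have h1 : 1 / (2 * δ) * ‖p‖ ^ 2 + δ / 2 * ‖q‖ ^ 2 - ‖p‖ * ‖q‖
      = (‖p‖ - δ * ‖q‖) ^ 2 / (2 * δ) := by field_simp; ring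
  have h3 : 0 ≤ (‖p‖ - δ * ‖q‖) ^ 2 / (2 * δ) := by positivity
  linarith

theorem abs_aForm_le (H : IsAdmissible M A σ α β h) {u v : E d → ℝ} (hu : u ∈ M.femSpace)
    (hv : v ∈ M.femSpace) (i : Fin M.card) {δ : ℝ} (hδ : 0 < δ) : |aForm A (M.elem i) u v|
      ≤ 1 / (2 * δ) * aForm A (M.elem i) u u + δ / 2 * aForm A (M.elem i) v v := by
  unfold aForm
  rw [← integral_const_mul, ← integral_const_mul, ← integral_add, ← Real.norm_eq_abs]
  · refine norm_integral_le_of_norm_le ?_ ?_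
    · exact ((H.integrableOn_coeff hu hu i).const_mul _).add
        ((H.integrableOn_coeff hv hv i).const_mul _)
    · filter_upwards [H.ae_elem i] with x hx
      rw [Real.norm_eq_abs, abs_mul, abs_of_nonneg hx.1]
      have := mul_le_mul_of_nonneg_left
        (abs_inner_le (gradient u x) (gradient v x) hδ) hx.1
      linarith
  · exact (H.integrableOn_coeff hu hu i).const_mul _
  · exact (H.integrableOn_coeff hv hv i).const_mul _

/-- The squared norm `|||u|||²` on an element. -/
noncomputable def energy (M : Mesh d Ω) (A : E d → ℝ) (τ : ℝ) (i : Fin M.card) (u : E d → ℝ) : ℝ :=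
  l2 (M.elem i) u u + τ ^ 2 / 4 * aForm A (M.elem i) u u

theorem energy_nonneg (H : IsAdmissible M A σ α β h) (τ : ℝ) (i : Fin M.card) (u : E d → ℝ) :
    0 ≤ energy M A τ i u :=
  add_nonneg (l2_self_nonneg _ _) (mul_nonneg (by positivity) (aForm_self_nonneg H i u))

/-- The sum of the moduli of the two parts of the bilinear form is bounded on every element. -/
theorem exists_local_bound (d : ℕ) (σ β : ℝ) (hσ : 0 < σ) (hβ : 0 < β) : ∃ c : ℝ, 1 ≤ c ∧
    ∀ (Ω : Set (E d)) (M : Mesh d Ω) (A : E d → ℝ) (α h : ℝ), IsAdmissible M A σ α β h →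
    ∀ τ : ℝ, 0 < τ → ∀ (i : Fin M.card) (y v z : E d → ℝ),
      y ∈ M.femSpace → v ∈ M.femSpace → z ∈ M.femSpace →
      (∀ e, |v (M.map i (corner e))| ≤ |z (M.map i (corner e))|) →
      |l2 (M.elem i) y v| + τ ^ 2 / 4 * |aForm A (M.elem i) y v|
        ≤ c * (1 + τ / h) / 2 * (energy M A τ i y + energy M A τ i z) := by
  obtain ⟨c, hc, hE⟩ := Mesh.exists_element_constants d σ hσ
  -- Chosen so that the final difference has nonnegative coefficients only. The lower bound `α` does
  -- not enter: the stiffness of `v` is controlled by the mass of `z` alone.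
  refine ⟨1 + c + β * c, by nlinarith, ?_⟩
  intro Ω M A α h H τ hτ i y v z hy hv hz hvz
  have hh := H.size_pos
  obtain ⟨b, hb, hbz, hvb, hgb⟩ := hE Ω M h hh H.quasiUniform i v z hv hz hvz
  have hfin : volume (M.elem i) ≠ ⊤ := (M.isCompact_elem i).measure_lt_top.ne
  change _ ≤ c * l2 (M.elem i) z z at hbz
  have h1 : l2 (M.elem i) v v ≤ c * l2 (M.elem i) z z := by
    refine le_trans ?_ hbz
    have := setIntegral_mono_on (IsAdmissible.integrableOn_mul hv hv i)
      (integrableOn_const hfin (C := b)) (M.measurableSet_elem i) hvb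
    rw [setIntegral_const, smul_eq_mul] at this
    exact this
  have h2 : aForm A (M.elem i) v v ≤ β * (c * l2 (M.elem i) z z) / h ^ 2 := by
    have : aForm A (M.elem i) v v ≤ volume.real (M.elem i) * (β * (b / h ^ 2)) := by
      rw [← smul_eq_mul, ← setIntegral_const]
      refine integral_mono_ae (H.integrableOn_coeff hv hv i) (integrableOn_const hfin) ?_
      filter_upwards [H.ae_elem i, M.ae_mem_interior_elem i] with x hx hxi
      rw [real_inner_self_eq_norm_sq]
      exact mul_le_mul hx.2 (hgb x hxi) (by positivity) H.upper_pos.le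
    refine this.trans ?_
    rw [le_div_iff₀ (by positivity)]
    have e : volume.real (M.elem i) * (β * (b / h ^ 2)) * h ^ 2
        = β * (volume.real (M.elem i) * b) := by field_simp
    rw [e]
    gcongr
  have h3 := abs_l2_le hy hv i one_pos
  -- The weight `h / τ` balances the `1 / h ^ 2` of the inverse estimate against `τ ^ 2`, leaving
  -- one power of `τ / h`.
  have h4 := abs_aForm_le H hy hv i (δ := h / τ) (by positivity)
  have hly := l2_self_nonneg (M.elem i) y
  have hlz := l2_self_nonneg (M.elem i) z
  have hay := aForm_self_nonneg H i y
  have haz := aForm_self_nonneg H i z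
  have h5 : τ ^ 2 / 4 * |aForm A (M.elem i) y v|
      ≤ τ / h / 2 * (τ ^ 2 / 4 * aForm A (M.elem i) y y)
        + β * c * (τ / h) / 8 * l2 (M.elem i) z z := by
    calc τ ^ 2 / 4 * |aForm A (M.elem i) y v|
        ≤ τ ^ 2 / 4 * (1 / (2 * (h / τ)) * aForm A (M.elem i) y y
          + h / τ / 2 * (β * (c * l2 (M.elem i) z z) / h ^ 2)) := by
          refine mul_le_mul_of_nonneg_left (h4.trans ?_) (by positivity)
          gcongr
      _ = _ := by field_simp; ring
  unfold energy
  set t := τ / h with ht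
  have ht0 : 0 < t := by positivity
  set ay := τ ^ 2 / 4 * aForm A (M.elem i) y y with hay'
  set az := τ ^ 2 / 4 * aForm A (M.elem i) z z with haz'
  have hay0 : 0 ≤ ay := by positivity
  have haz0 : 0 ≤ az := by positivity
  set ly := l2 (M.elem i) y y
  set lz := l2 (M.elem i) z z
  have hβ' := H.upper_pos
  have e : (1 + c + β * c) * (1 + t) / 2 * (ly + ay + (lz + az))
      - (1 / 2 * ly + c / 2 * lz + t / 2 * ay + β * c * t / 8 * lz)
      = (c + β * c + (1 + c + β * c) * t) / 2 * ly
        + (1 + c + β * c + (c + β * c) * t) / 2 * ay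
        + (1 + β * c + (1 + c) * t + 3 / 4 * (β * c * t)) / 2 * lz
        + (1 + c + β * c) * (1 + t) / 2 * az := by ring
  have : 0 ≤ (c + β * c + (1 + c + β * c) * t) / 2 * ly
        + (1 + c + β * c + (c + β * c) * t) / 2 * ay
        + (1 + β * c + (1 + c) * t + 3 / 4 * (β * c * t)) / 2 * lz
        + (1 + c + β * c) * (1 + t) / 2 * az := by positivity
  linarith

end Elementwise

end WaveCN

namespace WaveCN

/-! ### Energy loss from layer to layer and the resulting recursion. -/

section Decay

variable {d : ℕ} {Ω : Set (E d)} {M : Mesh d Ω} {A : E d → ℝ} {σ α β h : ℝ}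

/-- The squared norm `|||u|||²` outside of the `ℓ`-th order patch. -/
noncomputable def outerEnergy (M : Mesh d Ω) (A : E d → ℝ) (τ : ℝ) (S : Finset (Fin M.card))
    (ℓ : ℕ) (u : E d → ℝ) : ℝ :=
  ∑ i ∈ (M.layer S ℓ)ᶜ, energy M A τ i u

theorem outerEnergy_nonneg (H : IsAdmissible M A σ α β h) (τ : ℝ) (S : Finset (Fin M.card))
    (ℓ : ℕ) (u : E d → ℝ) : 0 ≤ outerEnergy M A τ S ℓ u :=
  Finset.sum_nonneg fun i _ => energy_nonneg H τ i u

theorem outerEnergy_succ_le (H : IsAdmissible M A σ α β h) (τ : ℝ) (S : Finset (Fin M.card))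
    (ℓ : ℕ) (u : E d → ℝ) : outerEnergy M A τ S (ℓ + 1) u ≤ outerEnergy M A τ S ℓ u :=
  Finset.sum_le_sum_of_subset_of_nonneg
    (Finset.compl_subset_compl.2 (M.layer_subset_succ S ℓ)) fun i _ _ => energy_nonneg H τ i u

theorem outerEnergy_le_sum (H : IsAdmissible M A σ α β h) (τ : ℝ) (S : Finset (Fin M.card))
    (ℓ : ℕ) (u : E d → ℝ) : outerEnergy M A τ S ℓ u ≤ ∑ i, energy M A τ i u :=
  Finset.sum_le_sum_of_subset_of_nonneg (Finset.subset_univ _) fun i _ _ => energy_nonneg H τ i u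

theorem tnorm_eq_sqrt_sum (H : IsAdmissible M A σ α β h) (τ : ℝ) {u : E d → ℝ}
    (hu : u ∈ M.femSpace) : tnorm A τ Ω u = √(∑ i, energy M A τ i u) := by
  simp only [tnorm, energy, Finset.sum_add_distrib, ← Finset.mul_sum]
  rw [H.l2_domain hu hu, H.aForm_domain hu hu]

theorem tnorm_diff_patch (H : IsAdmissible M A σ α β h) (τ : ℝ) (S : Finset (Fin M.card)) (ℓ : ℕ)
    {u : E d → ℝ} (hu : u ∈ M.femSpace) :
    tnorm A τ (Ω \ M.patch (M.elemUnion S) ℓ) u = √(outerEnergy M A τ S ℓ u) := by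
  simp only [tnorm, outerEnergy, energy, Finset.sum_add_distrib, ← Finset.mul_sum]
  rw [M.patch_eq, l2, aForm,
    setIntegral_congr_set (M.diff_interior_elemUnion_ae_eq H.isOpen (M.layer S ℓ)),
    setIntegral_congr_set (M.diff_interior_elemUnion_ae_eq H.isOpen (M.layer S ℓ)),
    M.integral_elemUnion _ (IsAdmissible.integrableOn_mul hu hu),
    M.integral_elemUnion _ (H.integrableOn_coeff hu hu)]
  rfl

/-- A function whose residual outside of a union of elements is controlled by two further functions
loses energy from layer to layer, up to the energy of these functions. -/
theorem exists_outerEnergy_step (d : ℕ) (σ β : ℝ) (hσ : 0 < σ) (hβ : 0 < β) : ∃ c : ℝ, 1 ≤ c ∧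
    ∀ (Ω : Set (E d)) (M : Mesh d Ω) (A : E d → ℝ) (α h : ℝ), IsAdmissible M A σ α β h →
    ∀ τ : ℝ, 0 < τ → ∀ (S : Finset (Fin M.card)) (z y₁ y₂ : E d → ℝ),
      z ∈ M.femSpace → y₁ ∈ M.femSpace → y₂ ∈ M.femSpace →
      (∀ v ∈ M.femSpace, (∀ i ∈ S, Set.EqOn v 0 (M.elem i)) →
        l2 Ω z v + τ ^ 2 / 4 * aForm A Ω z v
          = 2 * l2 Ω y₁ v - 2 * (τ ^ 2 / 4 * aForm A Ω y₁ v)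
            - (l2 Ω y₂ v + τ ^ 2 / 4 * aForm A Ω y₂ v)) →
      ∀ ℓ : ℕ, outerEnergy M A τ S (ℓ + 1) z
        ≤ 5 * (c * (1 + τ / h)) * (outerEnergy M A τ S ℓ z - outerEnergy M A τ S (ℓ + 1) z)
          + 6 * (c * (1 + τ / h)) * (outerEnergy M A τ S ℓ y₁ + outerEnergy M A τ S ℓ y₂) := by
  obtain ⟨c, hc, hloc⟩ := exists_local_bound d σ β hσ hβ
  refine ⟨c, hc, ?_⟩
  intro Ω M A α h H τ hτ S z y₁ y₂ hz hy₁ hy₂ hres ℓ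
  have hh := H.size_pos
  obtain ⟨v, hv, hv0, hvz, hvc⟩ := Mesh.exists_truncation H.isOpen hz S ℓ
  have hC : 1 ≤ c * (1 + τ / h) := by
    have : 0 < τ / h := by positivity
    nlinarith
  have hloc' : ∀ i y, y ∈ M.femSpace →
      |l2 (M.elem i) y v| + τ ^ 2 / 4 * |aForm A (M.elem i) y v|
        ≤ c * (1 + τ / h) / 2 * (energy M A τ i y + energy M A τ i z) := fun i y hy =>
    hloc Ω M A α h H τ hτ i y v z hy hv hz (hvc i)
  set C := c * (1 + τ / h) with hCdef
  -- The contribution of one element to the tested equation; the contributions sum to zero.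
  let r : Fin M.card → ℝ := fun i =>
    l2 (M.elem i) z v + τ ^ 2 / 4 * aForm A (M.elem i) z v
      - (2 * l2 (M.elem i) y₁ v - 2 * (τ ^ 2 / 4 * aForm A (M.elem i) y₁ v)
        - (l2 (M.elem i) y₂ v + τ ^ 2 / 4 * aForm A (M.elem i) y₂ v))
  have hsum : ∑ i, r i = 0 := by
    have := hres v hv fun i hi => hv0 i (M.layer_zero_subset S ℓ hi)
    rw [H.l2_domain hz hv, H.l2_domain hy₁ hv, H.l2_domain hy₂ hv, H.aForm_domain hz hv,
      H.aForm_domain hy₁ hv, H.aForm_domain hy₂ hv] at this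
    simp only [r, Finset.sum_sub_distrib, Finset.sum_add_distrib, ← Finset.mul_sum]
    linarith
  have hin : ∀ i ∈ M.layer S ℓ, r i = 0 := by
    intro i hi
    have e1 : ∀ y, l2 (M.elem i) y v = 0 := fun y =>
      (l2_congr (M.measurableSet_elem i) (Set.eqOn_refl y _) (hv0 i hi)).trans (l2_zero_right _ _)
    have e2 : ∀ y, aForm A (M.elem i) y v = 0 := fun y =>
      (aForm_congr i (Set.eqOn_refl y _) (hv0 i hi)).trans (aForm_zero_right _ _)
    simp [r, e1, e2]
  have hpart : ∀ y i, -(|l2 (M.elem i) y v| + τ ^ 2 / 4 * |aForm A (M.elem i) y v|)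
      ≤ l2 (M.elem i) y v + τ ^ 2 / 4 * aForm A (M.elem i) y v ∧
      -(|l2 (M.elem i) y v| + τ ^ 2 / 4 * |aForm A (M.elem i) y v|)
      ≤ -(l2 (M.elem i) y v - τ ^ 2 / 4 * aForm A (M.elem i) y v) := by
    intro y i
    have ht : 0 ≤ τ ^ 2 / 4 := by positivity
    have h1 := mul_le_mul_of_nonneg_left (neg_abs_le (aForm A (M.elem i) y v)) ht
    constructor <;> linarith [neg_abs_le (l2 (M.elem i) y v), le_abs_self (l2 (M.elem i) y v)]
  -- The forms of `z`, `y₁` and `y₂` carry weights 1, 2 and 1, and each costs `C / 2` times the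
  -- energy of `z`; the form of `z` costs that amount twice. This makes `5 / 2 * C`.
  have hring : ∀ i, -(5 / 2 * C * energy M A τ i z
      + 3 * C * (energy M A τ i y₁ + energy M A τ i y₂)) ≤ r i := by
    intro i
    have b0 := hloc' i z hz
    have b1 := hloc' i y₁ hy₁
    have b2 := hloc' i y₂ hy₂
    have p0 := (hpart z i).1
    have p1 := (hpart y₁ i).2
    have p2 := (hpart y₂ i).1
    have n1 := mul_nonneg (zero_le_one.trans hC) (energy_nonneg H τ i y₁)
    have n2 := mul_nonneg (zero_le_one.trans hC) (energy_nonneg H τ i y₂)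
    simp only [r]
    linarith
  have hout : ∀ i ∉ M.layer S (ℓ + 1), 1 / 2 * energy M A τ i z
      - 3 * C * (energy M A τ i y₁ + energy M A τ i y₂) ≤ r i := by
    intro i hi
    have e1 : ∀ y, l2 (M.elem i) y v = l2 (M.elem i) y z := fun y =>
      l2_congr (M.measurableSet_elem i) (Set.eqOn_refl y _) (hvz i hi)
    have e2 : ∀ y, aForm A (M.elem i) y v = aForm A (M.elem i) y z := fun y =>
      aForm_congr i (Set.eqOn_refl y _) (hvz i hi)
    -- With `δ = 1 / 3` and total weight 3 for `y₁` and `y₂`, half of the energy of `z` survives.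
    have b : ∀ y, y ∈ M.femSpace → |l2 (M.elem i) y z| + τ ^ 2 / 4 * |aForm A (M.elem i) y z|
        ≤ 3 / 2 * energy M A τ i y + 1 / 6 * energy M A τ i z := by
      intro y hy
      have b1 := abs_l2_le hy hz i (δ := 1 / 3) (by norm_num)
      have b2 := mul_le_mul_of_nonneg_left (abs_aForm_le H hy hz i (δ := 1 / 3) (by norm_num))
        (by positivity : 0 ≤ τ ^ 2 / 4)
      norm_num at b1 b2
      unfold energy
      linarith
    have p1 := (hpart y₁ i).2
    have p2 := (hpart y₂ i).1
    simp only [e1, e2] at p1 p2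
    have b1 := b y₁ hy₁
    have b2 := b y₂ hy₂
    have n1 := le_mul_of_one_le_left (energy_nonneg H τ i y₁) hC
    have n2 := le_mul_of_one_le_left (energy_nonneg H τ i y₂) hC
    have n3 := energy_nonneg H τ i y₂
    simp only [r, e1, e2]
    change _ ≤ energy M A τ i z - _
    linarith
  have hsub : (M.layer S (ℓ + 1))ᶜ ⊆ (M.layer S ℓ)ᶜ :=
    Finset.compl_subset_compl.2 (M.layer_subset_succ S ℓ)
  have hs1 : ∑ i ∈ (M.layer S ℓ)ᶜ, r i = 0 := by
    rw [← hsum]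
    exact Finset.sum_subset (Finset.subset_univ _) fun i _ hi =>
      hin i (by simpa using hi)
  rw [← Finset.sum_sdiff hsub] at hs1
  have hA := Finset.sum_le_sum fun i
    (_ : i ∈ (M.layer S ℓ)ᶜ \ (M.layer S (ℓ + 1))ᶜ) => hring i
  have hB := Finset.sum_le_sum fun i (hi : i ∈ (M.layer S (ℓ + 1))ᶜ) =>
    hout i (Finset.mem_compl.1 hi)
  simp only [Finset.sum_neg_distrib, Finset.sum_add_distrib, Finset.sum_sub_distrib,
    ← Finset.mul_sum] at hA hB
  have split : ∀ y, outerEnergy M A τ S ℓ y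
      = ∑ i ∈ (M.layer S ℓ)ᶜ \ (M.layer S (ℓ + 1))ᶜ, energy M A τ i y
        + outerEnergy M A τ S (ℓ + 1) y := fun y => (Finset.sum_sdiff hsub).symm
  change 1 / 2 * outerEnergy M A τ S (ℓ + 1) z - 3 * C * (outerEnergy M A τ S (ℓ + 1) y₁
    + outerEnergy M A τ S (ℓ + 1) y₂) ≤ _ at hB
  rw [split z, split y₁, split y₂]
  linarith

/-- Solution of the recursion for the energies outside of the patches. -/
theorem decay_of_recursion {m : ℕ → ℕ → ℝ} {g R : ℝ} {n : ℕ} (hg : 0 ≤ g) (hR : 0 ≤ R)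
    (hm : ∀ k ≤ n, ∀ ℓ, m k ℓ ≤ R) (h0 : ∀ ℓ, m 0 ℓ = 0)
    (h1 : 1 ≤ n → ∀ ℓ, m 1 (ℓ + 1) ≤ g * m 1 ℓ)
    (h2 : ∀ k, k + 2 ≤ n → ∀ ℓ,
      m (k + 2) (ℓ + 1) ≤ g * (m (k + 2) ℓ + 1 / 2 * (m (k + 1) ℓ + m k ℓ))) :
    ∀ k ≤ n, ∀ ℓ : ℕ, m k ℓ ≤ ((ℓ : ℝ) + 1) ^ k * g ^ ℓ * R := by
  intro k
  induction k using Nat.strong_induction_on with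
  | _ k ih =>
    intro hk ℓ
    match k, ih, hk with
    | 0, _, _ => rw [h0]; positivity
    | 1, _, hk =>
      have : m 1 ℓ ≤ g ^ ℓ * R := by
        induction ℓ with
        | zero => simpa using hm 1 hk 0
        | succ ℓ ihℓ =>
          refine (h1 hk ℓ).trans ?_
          rw [pow_succ, mul_comm _ g, mul_assoc]
          gcongr
      refine this.trans ?_
      rw [pow_one, mul_assoc]
      exact le_mul_of_one_le_left (by positivity) (by linarith [Nat.cast_nonneg (α := ℝ) ℓ])
    | k + 2, ih, hk =>
      induction ℓ with
      | zero => simpa using hm (k + 2) hk 0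
      | succ ℓ ihℓ =>
        have i1 := ih (k + 1) (by omega) (by omega) ℓ
        have i2 := ih k (by omega) (by omega) ℓ
        have hℓ : (0 : ℝ) ≤ ℓ := Nat.cast_nonneg ℓ
        have hgR : 0 ≤ g ^ ℓ * R := by positivity
        have i3 : ((ℓ : ℝ) + 1) ^ k * g ^ ℓ * R ≤ ((ℓ : ℝ) + 1) ^ (k + 1) * g ^ ℓ * R := by
          rw [mul_assoc, mul_assoc]
          exact mul_le_mul_of_nonneg_right
            (pow_le_pow_right₀ (by linarith) (Nat.le_succ k)) hgR
        -- The average of the two earlier terms is at most the bound of the later one; with `x = ℓ +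
        -- 1` this uses `x ^ (k + 2) + x ^ (k + 1) = x ^ (k + 1) * (x + 1)`.
        have i4 : m (k + 2) ℓ + 1 / 2 * (m (k + 1) ℓ + m k ℓ)
            ≤ (((ℓ : ℝ) + 1) ^ (k + 1) * (ℓ + 2)) * (g ^ ℓ * R) := by
          have e : (((ℓ : ℝ) + 1) ^ (k + 1) * (ℓ + 2)) * (g ^ ℓ * R)
            = ((ℓ : ℝ) + 1) ^ (k + 2) * g ^ ℓ * R + ((ℓ : ℝ) + 1) ^ (k + 1) * g ^ ℓ * R := by
            ring
          rw [e]
          linarith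
        have i5 : ((ℓ : ℝ) + 1) ^ (k + 1) * (ℓ + 2) ≤ ((ℓ : ℝ) + 2) ^ (k + 2) := by
          rw [pow_succ _ (k + 1)]
          gcongr
          linarith
        calc m (k + 2) (ℓ + 1) ≤ g * (m (k + 2) ℓ + 1 / 2 * (m (k + 1) ℓ + m k ℓ)) := h2 k hk ℓ
          _ ≤ g * (((ℓ : ℝ) + 2) ^ (k + 2) * (g ^ ℓ * R)) := by
            refine mul_le_mul_of_nonneg_left (i4.trans ?_) hg
            exact mul_le_mul_of_nonneg_right i5 hgR
          _ = (((ℓ + 1 : ℕ) : ℝ) + 1) ^ (k + 2) * g ^ (ℓ + 1) * R := by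
            push_cast; ring

end Decay

/-! ### Locality of the data and the scheme tested away from the source. -/

section CrankNicolson

variable {d : ℕ} {Ω : Set (E d)} {M : Mesh d Ω} {A : E d → ℝ} {σ α β h τ : ℝ}
  {S : Finset (Fin M.card)} {n : ℕ}

theorem eqOn_zero_of_notMem {u : E d → ℝ} (hu : u ∈ M.femSpace)
    (hs : tsupport u ⊆ M.elemUnion S) {i : Fin M.card} (hi : i ∉ S) :
    Set.EqOn u 0 (M.elem i) := by
  have h1 : Set.EqOn u 0 (interior (M.elem i)) := fun x hx =>
    image_eq_zero_of_notMem_tsupport fun ht =>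
      Set.disjoint_left.1 (M.disjoint_interior_elemUnion hi) hx (hs ht)
  rw [← M.closure_interior_elem i]
  exact h1.closure hu.1 continuous_const

theorem forms_eq_zero_of_tsupport_subset (H : IsAdmissible M A σ α β h) {u v : E d → ℝ}
    (hu : u ∈ M.femSpace) (hs : tsupport u ⊆ M.elemUnion S) (hv : v ∈ M.femSpace)
    (hv0 : ∀ i ∈ S, Set.EqOn v 0 (M.elem i)) : l2 Ω u v = 0 ∧ aForm A Ω u v = 0 := by
  rw [H.l2_domain hu hv, H.aForm_domain hu hv]
  constructor <;> refine Finset.sum_eq_zero fun i _ => ?_ <;> by_cases hi : i ∈ S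
  · rw [l2_congr (M.measurableSet_elem i) (Set.eqOn_refl u _) (hv0 i hi), l2_zero_right]
  · rw [l2_congr (M.measurableSet_elem i) (eqOn_zero_of_notMem hu hs hi) (Set.eqOn_refl v _),
      l2_zero_left]
  · rw [aForm_congr i (Set.eqOn_refl u _) (hv0 i hi), aForm_zero_right]
  · rw [aForm_congr i ((eqOn_zero_of_notMem hu hs hi).mono interior_subset) (Set.eqOn_refl v _),
      aForm_zero_left]

theorem eq_zero_of_mem_elemUnion {v : E d → ℝ} (hv0 : ∀ i ∈ S, Set.EqOn v 0 (M.elem i)) {x : E d}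
    (hx : x ∈ M.elemUnion S) : v x = 0 := by
  obtain ⟨i, hi, hxi⟩ := Set.mem_iUnion₂.1 hx
  exact hv0 i hi hxi

/-- The `L²`-projection of the source may spread beyond `ω`, but a test function in `V_h` sees only
the source itself. -/
theorem l2_source_eq_zero {g w v : E d → ℝ}
    (hg : ∀ᵐ x ∂volume.restrict Ω, x ∉ M.elemUnion S → g x = 0)
    (hw : IsL2Projection M g w ∨ tsupport w ⊆ M.elemUnion S) (hv : v ∈ M.femSpace)
    (hv0 : ∀ i ∈ S, Set.EqOn v 0 (M.elem i)) : l2 Ω w v = 0 := by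
  rcases hw with hw | hw
  · rw [hw.2 v hv]
    refine integral_eq_zero_of_ae ?_
    filter_upwards [hg] with x hx
    by_cases hxS : x ∈ M.elemUnion S
    · simp [eq_zero_of_mem_elemUnion hv0 hxS]
    · simp [hx hxS]
  · refine integral_eq_zero_of_ae (.of_forall fun x => ?_)
    by_cases hxS : x ∈ M.elemUnion S
    · simp [eq_zero_of_mem_elemUnion hv0 hxS]
    · simp [image_eq_zero_of_notMem_tsupport fun ht => hxS (hw ht)]

theorem halfStep_mem {u : ℕ → E d → ℝ} {k : ℕ} (h0 : u k ∈ M.femSpace)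
    (h1 : u (k + 1) ∈ M.femSpace) : halfStep u k ∈ M.femSpace :=
  M.femSpace.smul_mem _ (M.femSpace.add_mem h1 h0)

theorem l2_halfStep (H : IsAdmissible M A σ α β h) {u : ℕ → E d → ℝ} {v : E d → ℝ} {k : ℕ}
    (h0 : u k ∈ M.femSpace) (h1 : u (k + 1) ∈ M.femSpace) (hv : v ∈ M.femSpace) :
    l2 Ω (halfStep u k) v = 1 / 2 * (l2 Ω (u (k + 1)) v + l2 Ω (u k) v) := by
  rw [halfStep, IsAdmissible.l2_smul_left, H.l2_add_left h1 h0 hv]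

theorem aForm_halfStep (H : IsAdmissible M A σ α β h) {u : ℕ → E d → ℝ} {v : E d → ℝ} {k : ℕ}
    (h0 : u k ∈ M.femSpace) (h1 : u (k + 1) ∈ M.femSpace) (hv : v ∈ M.femSpace) :
    aForm A Ω (halfStep u k) v = 1 / 2 * (aForm A Ω (u (k + 1)) v + aForm A Ω (u k) v) := by
  rw [halfStep, H.aForm_smul_left _ (M.femSpace.add_mem h1 h0), H.aForm_add_left h1 h0 hv]

/-- The scheme, tested with a function that vanishes on the support of the source. -/
theorem IsCNSolution.homogeneous_step (H : IsAdmissible M A σ α β h) (hτ : 0 < τ)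
    {fh u : ℕ → E d → ℝ} (hu : IsCNSolution M A τ fh u n)
    (hf : ∀ k ≤ n + 1, fh k ∈ M.femSpace) {v : E d → ℝ} (hv : v ∈ M.femSpace)
    (hfv : ∀ k ≤ n + 1, l2 Ω (fh k) v = 0) {k : ℕ} (hk : k + 1 ≤ n) :
    l2 Ω (u (k + 2)) v - 2 * l2 Ω (u (k + 1)) v + l2 Ω (u k) v
      + τ ^ 2 / 4 * (aForm A Ω (u (k + 2)) v + 2 * aForm A Ω (u (k + 1)) v
        + aForm A Ω (u k) v) = 0 := by
  have m0 := hu.1 k (by omega)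
  have m1 := hu.1 (k + 1) (by omega)
  have m2 := hu.1 (k + 2) (by omega)
  have f0 := hf k (by omega)
  have f1 := hf (k + 1) (by omega)
  have f2 := hf (k + 2) (by omega)
  have m1' : ∀ (r : ℝ) {w : E d → ℝ}, w ∈ M.femSpace → r • w ∈ M.femSpace := fun r _ hw =>
    M.femSpace.smul_mem r hw
  have hs := hu.2 (k + 1) (by omega) hk v hv
  have e1 : secondDiff τ u (k + 1) = (τ ^ 2)⁻¹ • (u (k + 2) + (-2 : ℝ) • u (k + 1) + u k) := by
    rw [secondDiff, neg_smul, ← sub_eq_add_neg]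
    rfl
  have e2 : ∀ w : ℕ → E d → ℝ,
      avg w (k + 1) = (1 / 4 : ℝ) • (w (k + 2) + (2 : ℝ) • w (k + 1) + w k) := fun _ => rfl
  rw [e1, e2, e2, IsAdmissible.l2_smul_left, IsAdmissible.l2_smul_left,
    H.aForm_smul_left _ (M.femSpace.add_mem (M.femSpace.add_mem m2 (m1' _ m1)) m0),
    H.l2_add_left (M.femSpace.add_mem m2 (m1' _ m1)) m0 hv, H.l2_add_left m2 (m1' _ m1) hv,
    H.aForm_add_left (M.femSpace.add_mem m2 (m1' _ m1)) m0 hv, H.aForm_add_left m2 (m1' _ m1) hv,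
    H.l2_add_left (M.femSpace.add_mem f2 (m1' _ f1)) f0 hv, H.l2_add_left f2 (m1' _ f1) hv,
    IsAdmissible.l2_smul_left, IsAdmissible.l2_smul_left, H.aForm_smul_left _ m1,
    hfv k (by omega), hfv (k + 1) (by omega), hfv (k + 2) (by omega)] at hs
  have := congrArg (τ ^ 2 * ·) hs
  field_simp at this
  linarith

theorem energy_halfStep_zero {u : ℕ → E d → ℝ} (m0 : u 0 ∈ M.femSpace) (m1 : u 1 ∈ M.femSpace)
    (h0 : tsupport (u 0) ⊆ M.elemUnion S) (h1 : tsupport (u 1) ⊆ M.elemUnion S)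
    {i : Fin M.card} (hi : i ∉ S) : energy M A τ i (halfStep u 0) = 0 := by
  have hz : Set.EqOn (halfStep u 0) 0 (M.elem i) := fun x hx => by
    simp [halfStep, eqOn_zero_of_notMem m0 h0 hi hx, eqOn_zero_of_notMem m1 h1 hi hx]
  rw [energy, l2_congr (M.measurableSet_elem i) hz hz,
    aForm_congr i (hz.mono interior_subset) hz, l2_zero_left, aForm_zero_left]
  simp

theorem outerEnergy_halfStep_zero {u : ℕ → E d → ℝ} (m0 : u 0 ∈ M.femSpace)
    (m1 : u 1 ∈ M.femSpace) (h0 : tsupport (u 0) ⊆ M.elemUnion S)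
    (h1 : tsupport (u 1) ⊆ M.elemUnion S) (ℓ : ℕ) :
    outerEnergy M A τ S ℓ (halfStep u 0) = 0 :=
  Finset.sum_eq_zero fun _ hi => energy_halfStep_zero m0 m1 h0 h1 fun hS =>
    Finset.mem_compl.1 hi (M.layer_zero_subset S ℓ hS)

end CrankNicolson

/-! ### The decay factor and the conclusion. -/

section DecayFactor

theorem decayFactor_sq {C : ℝ} (hC : 0 ≤ C) : decayFactor C ^ 2 = (C + 1 / 2) / (1 + C) :=
  Real.sq_sqrt (by positivity)

theorem decayFactor_pos {C : ℝ} (hC : 0 ≤ C) : 0 < decayFactor C :=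
  Real.sqrt_pos.2 (by positivity)

theorem decayFactor_lt_one {C : ℝ} (hC : 0 ≤ C) : decayFactor C < 1 := by
  rw [decayFactor, Real.sqrt_lt' one_pos, one_pow, div_lt_one (by positivity)]
  linarith

/-- Here `5 * D ≤ C` and `6 * D ≤ C / 2`, so moving `C * x` to the left gives `(1 + C) * x ≤ C * (y
+ w / 2)`. -/
theorem le_decayFactor_sq_mul {C D x y w : ℝ} (hD : 0 ≤ D) (hC : 12 * D ≤ C)
    (hx : 0 ≤ x) (hxy : x ≤ y) (hw : 0 ≤ w) (h : x ≤ 5 * D * (y - x) + 6 * D * w) :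
    x ≤ decayFactor C ^ 2 * (y + 1 / 2 * w) := by
  have hC0 : 0 ≤ C := by linarith
  rw [decayFactor_sq hC0, div_mul_eq_mul_div, le_div_iff₀ (by positivity)]
  have h1 : 5 * D * (y - x) ≤ C * (y - x) := by
    apply mul_le_mul_of_nonneg_right <;> linarith
  have h2 : 6 * D * w ≤ C / 2 * w := by
    apply mul_le_mul_of_nonneg_right <;> linarith
  linarith

end DecayFactor

end WaveCN

theorem lemma3p1 (d : ℕ) (hd : 1 ≤ d) (σ α β : ℝ) (hσ : 0 < σ) (hα : 0 < α) (hαβ : α ≤ β) :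
    ∃ (c₁ c₂ : ℝ) (C : ℝ → ℝ → ℝ), 0 < c₁ ∧ 0 < c₂ ∧
      (∀ τ h : ℝ, 0 < τ → 0 < h →
        c₁ * (β / α * (τ / h + h / τ)) ≤ C τ h ∧ C τ h ≤ c₂ * (β / α * (τ / h + h / τ)) ∧
        0 < WaveCN.decayFactor (C τ h) ∧ WaveCN.decayFactor (C τ h) < 1) ∧
      ∀ (Ω : Set (WaveCN.E d)), IsOpen Ω → Bornology.IsBounded Ω → IsConnected Ω →
      ∀ (A : WaveCN.E d → ℝ), AEMeasurable A (volume.restrict Ω) →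
        (∀ᵐ x ∂volume.restrict Ω, α ≤ A x ∧ A x ≤ β) →
      ∀ (M : WaveCN.Mesh d Ω) (h : ℝ), 0 < h → M.IsQuasiUniform σ h →
      ∀ (τ : ℝ), 0 < τ →
      ∀ (S : Finset (Fin M.card)) (n : ℕ)
        (f : ℝ → WaveCN.E d → ℝ) (fh u : ℕ → WaveCN.E d → ℝ),
        -- the source is square integrable and supported in the union `ω` of the elements in `S`
        (∀ k ≤ n + 1, MemLp (f (k * τ)) 2 (volume.restrict Ω) ∧
          ∀ᵐ x ∂volume.restrict Ω, x ∉ M.elemUnion S → f (k * τ) x = 0) →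
        -- its discretization is the `L²`-projection or any other choice supported in `ω`
        (∀ k ≤ n + 1, fh k ∈ M.femSpace ∧
          (WaveCN.IsL2Projection M (f (k * τ)) (fh k) ∨ tsupport (fh k) ⊆ M.elemUnion S)) →
        WaveCN.IsCNSolution M A τ fh u n →
        tsupport (u 0) ⊆ M.elemUnion S → tsupport (u 1) ⊆ M.elemUnion S →
        ∀ ℓ : ℕ,
          WaveCN.tnorm A τ (Ω \ M.patch (M.elemUnion S) ℓ) (WaveCN.halfStep u n) ≤
            ((ℓ : ℝ) + 1) ^ ((n : ℝ) / 2) * WaveCN.decayFactor (C τ h) ^ ℓ *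
              (Finset.range (n + 1)).sup' Finset.nonempty_range_add_one
                (fun k => WaveCN.tnorm A τ Ω (WaveCN.halfStep u k)) := by
  open WaveCN in
  have hβ : 0 < β := hα.trans_le hαβ
  obtain ⟨c, hc, hstep⟩ := exists_outerEnergy_step d σ β hσ hβ
  have hK : 0 < 24 * c := by linarith
  have hC0 : ∀ τ h : ℝ, 0 < τ → 0 < h → 0 ≤ 24 * c * (β / α * (τ / h + h / τ)) := by
    intro τ h hτ hh
    positivity
  refine ⟨24 * c, 24 * c, fun τ h => 24 * c * (β / α * (τ / h + h / τ)), hK, hK,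
    fun τ h hτ hh => ⟨le_rfl, le_rfl, decayFactor_pos (hC0 τ h hτ hh),
      decayFactor_lt_one (hC0 τ h hτ hh)⟩, ?_⟩
  intro Ω hΩ _ _ A hA hAb M h hh hq τ hτ S n f fh u hf hfh hu hu0 hu1 ℓ
  have H : IsAdmissible M A σ α β h := ⟨hΩ, hA, hAb, hα, hαβ, hσ, hh, hq⟩
  -- The 24 is twice the 12 required for absorption, since `1 + t ≤ 2 * (t + 1 / t)` for `t = τ /
  -- h`, and `β / α ≥ 1`.
  have hD : 12 * (c * (1 + τ / h)) ≤ 24 * c * (β / α * (τ / h + h / τ)) := by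
    have h1 : 1 ≤ β / α := (one_le_div hα).2 hαβ
    have ht : 0 < τ / h := by positivity
    have h2 : 1 + τ / h ≤ 2 * (τ / h + h / τ) := by
      have e : h / τ = 1 / (τ / h) := by field_simp
      rw [e]
      set t := τ / h
      have : 0 ≤ 2 * (t + 1 / t) - (1 + t) := by
        have e : 2 * (t + 1 / t) - (1 + t) = (t ^ 2 - t + 2) / t := by field_simp; ring
        rw [e]
        apply div_nonneg _ ht.le
        nlinarith [sq_nonneg (t - 1 / 2)]
      linarith
    have h3 : 0 ≤ τ / h + h / τ := by positivity
    have h4 := le_mul_of_one_le_left h3 h1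
    calc 12 * (c * (1 + τ / h)) = 12 * c * (1 + τ / h) := by ring
      _ ≤ 12 * c * (2 * (β / α * (τ / h + h / τ))) := by
        refine mul_le_mul_of_nonneg_left ?_ (by linarith)
        linarith
      _ = _ := by ring
  have hD0 : 0 ≤ c * (1 + τ / h) := by positivity
  set C := 24 * c * (β / α * (τ / h + h / τ)) with hCdef
  have hC := hC0 τ h hτ hh
  have hzmem : ∀ k ≤ n, halfStep u k ∈ M.femSpace := fun k hk =>
    halfStep_mem (hu.1 k (by omega)) (hu.1 (k + 1) (by omega))
  have hsrc : ∀ v ∈ M.femSpace, (∀ i ∈ S, Set.EqOn v 0 (M.elem i)) →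
      ∀ k ≤ n + 1, l2 Ω (fh k) v = 0 := fun v hv hv0 k hk =>
    l2_source_eq_zero (hf k hk).2 (hfh k hk).2 hv hv0
  have hscheme : ∀ v ∈ M.femSpace, (∀ i ∈ S, Set.EqOn v 0 (M.elem i)) → ∀ k, k + 1 ≤ n → _ :=
    fun v hv hv0 k hk =>
      hu.homogeneous_step H hτ (fun k hk => (hfh k hk).1) hv (hsrc v hv hv0) hk
  have m0 := hu.1 0 (by omega)
  have m1 := hu.1 1 (by omega)
  set R := (Finset.range (n + 1)).sup' Finset.nonempty_range_add_one
    (fun k => tnorm A τ Ω (halfStep u k)) with hRdef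
  have hR : ∀ k ≤ n, tnorm A τ Ω (halfStep u k) ≤ R := fun k hk =>
    Finset.le_sup' (fun k => tnorm A τ Ω (halfStep u k)) (Finset.mem_range.2 (by omega))
  have hR0 : 0 ≤ R := (Real.sqrt_nonneg _).trans (hR 0 (Nat.zero_le n))
  have hdecay := decay_of_recursion (m := fun k ℓ => outerEnergy M A τ S ℓ (halfStep u k))
    (g := decayFactor C ^ 2) (R := R ^ 2) (n := n) (sq_nonneg _) (sq_nonneg _)
    (fun k hk ℓ => by
      refine (outerEnergy_le_sum H τ S ℓ _).trans ?_
      have := hR k hk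
      rw [tnorm_eq_sqrt_sum H τ (hzmem k hk)] at this
      exact (Real.sqrt_le_left hR0).1 this)
    (outerEnergy_halfStep_zero m0 m1 hu0 hu1)
    -- In the first time step the initial values drop out when tested away from `ω`, so `u 2` alone
    -- has zero residual and both perturbations are zero.
    (fun hn ℓ => by
      have hz := hzmem 1 hn
      have := hstep Ω M A α h H τ hτ S (halfStep u 1) 0 0 hz M.femSpace.zero_mem
        M.femSpace.zero_mem (fun v hv hv0 => by
          have hs := hscheme v hv hv0 0 hn
          have z0 := forms_eq_zero_of_tsupport_subset H m0 hu0 hv hv0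
          have z1 := forms_eq_zero_of_tsupport_subset H m1 hu1 hv hv0
          rw [l2_zero_left, aForm_zero_left, l2_halfStep H m1 (hu.1 2 (by omega)) hv,
            aForm_halfStep H m1 (hu.1 2 (by omega)) hv]
          simp only [Nat.zero_add, z0.1, z0.2, z1.1, z1.2] at hs ⊢
          linarith) ℓ
      have e : outerEnergy M A τ S ℓ (0 : E d → ℝ) = 0 :=
        Finset.sum_eq_zero fun i _ => by simp [energy, l2_zero_left, aForm_zero_left]
      rw [e, add_zero] at this
      have := le_decayFactor_sq_mul hD0 hD (outerEnergy_nonneg H τ S _ _)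
        (outerEnergy_succ_le H τ S ℓ _) le_rfl this
      simpa using this)
    -- Half the sum of the scheme at steps `k + 1` and `k + 2` is the three-term relation for the
    -- half-step values.
    (fun k hk ℓ => by
      refine le_decayFactor_sq_mul hD0 hD (outerEnergy_nonneg H τ S _ _)
        (outerEnergy_succ_le H τ S ℓ _) (add_nonneg (outerEnergy_nonneg H τ S _ _)
          (outerEnergy_nonneg H τ S _ _)) ?_
      refine hstep Ω M A α h H τ hτ S _ _ _ (hzmem _ hk) (hzmem _ (by omega))
        (hzmem _ (by omega)) (fun v hv hv0 => ?_) ℓ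
      have hs0 := hscheme v hv hv0 k (by omega)
      have hs1 := hscheme v hv hv0 (k + 1) hk
      have q0 := hu.1 k (by omega)
      have q1 := hu.1 (k + 1) (by omega)
      have q2 := hu.1 (k + 2) (by omega)
      have q3 := hu.1 (k + 3) (by omega)
      rw [l2_halfStep H q2 q3 hv, l2_halfStep H q1 q2 hv, l2_halfStep H q0 q1 hv,
        aForm_halfStep H q2 q3 hv, aForm_halfStep H q1 q2 hv, aForm_halfStep H q0 q1 hv]
      simp only [Nat.add_assoc, Nat.reduceAdd] at hs0 hs1 ⊢
      linarith)
    n le_rfl ℓ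
  rw [tnorm_diff_patch H τ S ℓ (hzmem n le_rfl)]
  have hγ := (decayFactor_pos hC).le
  refine (Real.sqrt_le_left (by positivity)).2 (hdecay.trans (le_of_eq ?_))
  have hp : (((ℓ : ℝ) + 1) ^ ((n : ℝ) / 2)) ^ 2 = ((ℓ : ℝ) + 1) ^ n := by
    rw [← Real.rpow_natCast, ← Real.rpow_mul (by positivity), ← Real.rpow_natCast]
    congr 1
    push_cast
    ring
  rw [mul_pow, mul_pow, hp, ← pow_mul, ← pow_mul, mul_comm ℓ 2]
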